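/- **Signals and systems.** A signal is a function $u:[0,\infty)\to\mathbb R^m$ that is right-continuous and piecewise continuous (finitely many discontinuities in each compact interval, with finite left limits); $\mathcal S^m$ is the set of these and $\mathcal S=\mathcal S^1$. State trajectories are continuous, and differential equations are understood with right derivatives, at every $t\ge 0$. A real rational function is called a stable transfer function if it is proper and all its poles lie in $\{s\in\mathbb C : \operatorname{Re}s<0\}$. For a stable transfer function $\delta$ and $z\in\mathcal S$, $w=\delta z$ is the output of $\dot x=A_\delta x+B_\delta z$, $w=C_\delta x+D_\delta z$, $x(0)=0$, where $(A_\delta,B_\delta,C_\delta,D_\delta)$ is a minimal (controllable and observable) realization of $\delta$. **Data.** Let $P_0=\begin{pmatrix}q&s\\ s&r\end{pmatrix}$ be a real symmetric matrix with $r\le 0$. Let $\psi$ be an $l\times 1$ matrix of stable transfer functions with a realization $\psi(s)=C_\psi(sI-A_\psi)^{-1}B_\psi+D_\psi$, $A_\psi\in\mathbb R^{n\times n}$, let $M\in\mathbb R^{l\times l}$ be symmetric, and let $K=K^T\in\mathbb R^{n\times n}$ be a certificate of $\psi^*M\psi\succ 0$ for this realization, that is, $$\begin{pmatrix}A_\psi&B_\psi\\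 I&0\end{pmatrix}^T\begin{pmatrix}0&K\\K&0\end{pmatrix}\begin{pmatrix}A_\psi&B_\psi\\ I&0\end{pmatrix}\prec\begin{pmatrix}C_\psi&D_\psi\end{pmatrix}^TM\begin{pmatrix}C_\psi&D_\psi\end{pmatrix}.$$ For $z\in\mathcal S$ let $\boldsymbol\Delta_{\rm dy}(z)$ be the set of all $\delta z$, where $\delta$ ranges over all stable transfer functions (of any degree) with $$\begin{pmatrix}1\\ \delta(i\omega)\end{pmatrix}^*P_0\begin{pmatrix}1\\ \delta(i\omega)\end{pmatrix}>0\quad\text{for all }\omega\in\mathbb R\cup\{\infty\}.$$ **Theorem.** The uncertainty $\boldsymbol\Delta_{\rm dy}$ satisfies a finite-horizon IQC with multiplier $\operatorname{diag}(\psi,\psi)^*(P_0\otimes M)\operatorname{diag}(\psi,\psi)$ and terminal cost matrix $Z=P_0\otimes K$ (which is symmetric). That is, for all $z\in\mathcal S$ and all $w\in\boldsymbol\Delta_{\rm dy}(z)$, the response of the realization of $\operatorname{diag}(\psi,\psi)$ given by $$\dot\xi=\begin{pmatrix}A_\psi&0\\0&A_\psi\end{pmatrix}\xi+\begin{pmatrix}B_\psi&0\\0&B_\psi\end{pmatrix}\begin{pmatrix}z\\w\end{pmatrix},\quad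 \xi(0)=0,\qquad v=\begin{pmatrix}C_\psi&0\\0&C_\psi\end{pmatrix}\xi+\begin{pmatrix}D_\psi&0\\0&D_\psi\end{pmatrix}\begin{pmatrix}z\\w\end{pmatrix}$$ satisfies $$\int_0^Tv(t)^T(P_0\otimes M)\,v(t)\,dt-\xi(T)^T(P_0\otimes K)\,\xi(T)\ \ge\ 0\qquad\text{for all }T\ge 0.$$ -/

import Mathlib

open Matrix Set Filter Topology
open scoped ComplexOrder

noncomputable section

/-! ### Signals -/

/-- The signal space: functions that, on the time set `[0, ∞)`, are right-continuous and piecewise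
continuous (finitely many discontinuities in every compact interval, all with finite left limits).
Time functions are defined on `ℝ`, but only their values on `[0, ∞)` are ever used. -/
def IsSignal {μ : Type*} (u : ℝ → μ → ℝ) : Prop :=
  (∀ t : ℝ, 0 ≤ t → ContinuousWithinAt u (Ici t) t) ∧
  (∀ t : ℝ, 0 < t → ∃ a : μ → ℝ, Tendsto u (𝓝[<] t) (𝓝 a)) ∧
  (∀ T : ℝ, {t ∈ Icc 0 T | ¬ ContinuousWithinAt u (Ici 0) t}.Finite)

/-! ### Linear systems -/

/-- A state-space description `ẋ = A x + B u`, `y = C x + D u` with state index type `ν`,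
input index type `μ` and output index type `κ`. -/
structure StateSpace (ν μ κ : Type*) where
  A : Matrix ν ν ℝ
  B : Matrix ν μ ℝ
  C : Matrix κ ν ℝ
  D : Matrix κ μ ℝ

namespace StateSpace

/-- The response `(x, y)` on `[0, ∞)` to the input `u` and the initial condition `x₀`: the state is
continuous and has everywhere a right derivative, given by the differential equation. (For a signal
`u` it follows from the equations that `x`, `ẋ` and `y` are signals.) -/
def IsResponse {ν μ κ : Type*} [Fintype ν] [Fintype μ] (sys : StateSpace ν μ κ)
    (x₀ : ν → ℝ) (u : ℝ → μ → ℝ) (x : ℝ → ν → ℝ) (y : ℝ → κ → ℝ) : Prop :=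
  x 0 = x₀ ∧ ContinuousOn x (Ici 0) ∧
  (∀ t : ℝ, 0 ≤ t → HasDerivWithinAt x (sys.A *ᵥ x t + sys.B *ᵥ u t) (Ici t) t) ∧
  (∀ t : ℝ, 0 ≤ t → y t = sys.C *ᵥ x t + sys.D *ᵥ u t)

/-- The transfer matrix `C (s I - A)⁻¹ B + D`, with entries in the field `ℝ(s)`. -/
def transferMatrix {ν μ κ : Type*} [Fintype ν] [DecidableEq ν] (sys : StateSpace ν μ κ) :
    Matrix κ μ (RatFunc ℝ) :=
  sys.C.map RatFunc.C *
    ((RatFunc.X : RatFunc ℝ) • (1 : Matrix ν ν (RatFunc ℝ)) - sys.A.map RatFunc.C)⁻¹ *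
    sys.B.map RatFunc.C + sys.D.map RatFunc.C

/-- The columns of `B, A B, A² B, …` span the state space. -/
def IsControllable {ν μ κ : Type*} [Fintype ν] [DecidableEq ν] [Fintype μ]
    (sys : StateSpace ν μ κ) : Prop :=
  Submodule.span ℝ {x : ν → ℝ | ∃ (i : ℕ) (u : μ → ℝ), x = sys.A ^ i *ᵥ (sys.B *ᵥ u)} = ⊤

/-- The common kernel of `C, C A, C A², …` is trivial. -/
def IsObservable {ν μ κ : Type*} [Fintype ν] [DecidableEq ν]
    (sys : StateSpace ν μ κ) : Prop :=
  ∀ x : ν → ℝ, (∀ i : ℕ, sys.C *ᵥ (sys.A ^ i *ᵥ x) = 0) → x = 0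

/-- A realization is minimal if it is controllable and observable. -/
def IsMinimal {ν μ κ : Type*} [Fintype ν] [DecidableEq ν] [Fintype μ]
    (sys : StateSpace ν μ κ) : Prop :=
  sys.IsControllable ∧ sys.IsObservable

/-- The block-diagonal combination of two systems; its transfer matrix is the block-diagonal
matrix of the two transfer matrices. -/
def diag {ν₁ μ₁ κ₁ ν₂ μ₂ κ₂ : Type*} (sys₁ : StateSpace ν₁ μ₁ κ₁) (sys₂ : StateSpace ν₂ μ₂ κ₂) :
    StateSpace (ν₁ ⊕ ν₂) (μ₁ ⊕ μ₂) (κ₁ ⊕ κ₂) where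
  A := fromBlocks sys₁.A 0 0 sys₂.A
  B := fromBlocks sys₁.B 0 0 sys₂.B
  C := fromBlocks sys₁.C 0 0 sys₂.C
  D := fromBlocks sys₁.D 0 0 sys₂.D

/-- `K = Kᵀ` certifies, for the given realization of `G`, the strict frequency domain inequality
`G* M G ≻ 0`: the strict dissipation LMI
`[A B; I 0]ᵀ [0 K; K 0] [A B; I 0] ≺ [C D]ᵀ M [C D]` holds. -/
def IsCertificate {ν μ κ : Type*} [Fintype ν] [DecidableEq ν] [Fintype κ]
    (sys : StateSpace ν μ κ) (M : Matrix κ κ ℝ) (K : Matrix ν ν ℝ) : Prop :=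
  K.IsSymm ∧
  ((fromCols sys.C sys.D)ᵀ * M * fromCols sys.C sys.D -
    (fromBlocks sys.A sys.B (1 : Matrix ν ν ℝ) (0 : Matrix ν μ ℝ))ᵀ * fromBlocks 0 K K 0 *
      fromBlocks sys.A sys.B (1 : Matrix ν ν ℝ) (0 : Matrix ν μ ℝ)).PosDef

end StateSpace

/-! ### Transfer functions -/

/-- A real rational function is a stable transfer function if it is proper and all its complex
poles lie in the open left half-plane. (`num` and `denom` are coprime.) -/
def IsStableTransferFunction (g : RatFunc ℝ) : Prop :=
  g.num.natDegree ≤ g.denom.natDegree ∧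
  ∀ s : ℂ, Polynomial.aeval s g.denom = 0 → s.re < 0

/-- The value at `∞` of a proper rational function (its denominator is normalized to be monic). -/
def valueAtInfinity (g : RatFunc ℝ) : ℝ :=
  g.num.coeff g.denom.natDegree

/-- The strict frequency domain inequality `G* P G ≻ 0` on the extended imaginary axis, for a
transfer matrix `G` that is proper and without poles on the imaginary axis. -/
def StrictFDI {κ μ : Type*} [Fintype κ] (G : Matrix κ μ (RatFunc ℝ)) (P : Matrix κ κ ℝ) : Prop :=
  (∀ ω : ℝ,
    ((G.map (RatFunc.eval (algebraMap ℝ ℂ) (Complex.I * ω)))ᴴ * P.map (algebraMap ℝ ℂ) *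
      G.map (RatFunc.eval (algebraMap ℝ ℂ) (Complex.I * ω))).PosDef) ∧
  ((G.map valueAtInfinity)ᵀ * P * G.map valueAtInfinity).PosDef

/-- `w = δ z`: `w` is the zero-initial-state response to `z` of a minimal realization of `δ`. -/
def IsFilteredBy (δ : RatFunc ℝ) (z w : ℝ → Fin 1 → ℝ) : Prop :=
  ∃ (n : ℕ) (sys : StateSpace (Fin n) (Fin 1) (Fin 1)) (x : ℝ → Fin n → ℝ),
    sys.IsMinimal ∧ sys.transferMatrix = !![δ] ∧ sys.IsResponse 0 z x w

/-- The dynamic uncertainty: to a signal `z` it assigns all `w = δ z`, where `δ` ranges over the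
stable transfer functions with `[1; δ]* P₀ [1; δ] ≻ 0` on the extended imaginary axis. -/
def dynamicUncertainty (P₀ : Matrix (Fin 2) (Fin 2) ℝ) (z : ℝ → Fin 1 → ℝ) :
    Set (ℝ → Fin 1 → ℝ) :=
  {w | IsSignal w ∧ ∃ δ : RatFunc ℝ,
    IsStableTransferFunction δ ∧ StrictFDI !![1; δ] P₀ ∧ IsFilteredBy δ z w}

/-! ### Integral quadratic constraints -/

/-- The Kronecker product `P₀ ⊗ N` for a `2 × 2` matrix `P₀`, as a two-by-two block matrix. -/
def kroneckerTwo {κ : Type*} (P₀ : Matrix (Fin 2) (Fin 2) ℝ) (N : Matrix κ κ ℝ) :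
    Matrix (κ ⊕ κ) (κ ⊕ κ) ℝ :=
  fromBlocks (P₀ 0 0 • N) (P₀ 0 1 • N) (P₀ 1 0 • N) (P₀ 1 1 • N)

theorem kroneckerTwo_apply {κ : Type*} (P₀ : Matrix (Fin 2) (Fin 2) ℝ) (N : Matrix κ κ ℝ) :
    kroneckerTwo P₀ N = (kroneckerMap (fun a b => a * b) P₀ N).submatrix
      (Sum.elim (fun i => (0, i)) (fun i => (1, i)))
      (Sum.elim (fun i => (0, i)) (fun i => (1, i))) := by
  ext (i | i) (j | j) <;> simp [kroneckerTwo]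

/-- The uncertainty `Δ` satisfies a finite-horizon IQC for the multiplier `Ψ* P Ψ` with terminal
cost matrix `Z`, the filter `Ψ = (Ψ₁ Ψ₂)` being realized by `sys`: with the filter state `ξ`,
`ξ(0) = 0`, and output `v = Ψ₁ z + Ψ₂ w`, it holds that
`∫₀ᵀ v(t)ᵀ P v(t) dt - ξ(T)ᵀ Z ξ(T) ≥ 0` for all `T ≥ 0` and all `w ∈ Δ(z)`. -/
def SatisfiesIQC {k m ν π : Type*} [Fintype k] [Fintype m] [Fintype ν] [DecidableEq ν] [Fintype π]
    (Δ : (ℝ → k → ℝ) → Set (ℝ → m → ℝ)) (Ψ : Matrix π (k ⊕ m) (RatFunc ℝ))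
    (sys : StateSpace ν (k ⊕ m) π) (P : Matrix π π ℝ) (Z : Matrix ν ν ℝ) : Prop :=
  sys.transferMatrix = Ψ ∧ P.IsSymm ∧ Z.IsSymm ∧
  ∀ (z : ℝ → k → ℝ) (w : ℝ → m → ℝ), IsSignal z → IsSignal w → w ∈ Δ z →
    ∀ (ξ : ℝ → ν → ℝ) (v : ℝ → π → ℝ),
      sys.IsResponse 0 (fun t => Sum.elim (z t) (w t)) ξ v →
      ∀ T : ℝ, 0 ≤ T →
        0 ≤ (∫ t in (0 : ℝ)..T, v t ⬝ᵥ (P *ᵥ v t)) - ξ T ⬝ᵥ (Z *ᵥ ξ T)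

end

/-!
# Dynamic uncertainties satisfy a finite-horizon integral quadratic constraint

Let `η₁ = (ξ₁, z)` and `η₂ = (ξ₂, w)` collect states and inputs of the two copies of the filter.
By the certificate inequality, the supply rate `vᵀ (P₀ ⊗ M) v` minus the derivative of the storage
function `ξᵀ (P₀ ⊗ K) ξ` equals `∑ P₀ i j * ηᵢᵀ Q ηⱼ` with a matrix `Q ≻ 0` that does not depend
on `P₀` (`StateSpace.IsCertificate.exists_sum_of_squares`). Writing `Q` as a sum of squares of
linear forms `(c, e)` and setting `yᵢ = c ξᵢ + e uᵢ`, where `u₁ = z` and `u₂ = w`, reduces the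
claim to `∫₀ᵀ (q y₁² + 2 s y₁ y₂ + r y₂²) dt ≥ 0` for each of the forms.

The signal `y₂` is the response to `w = δ z` of the same system that yields `y₁` from `z`. Scalar
systems with zero initial state commute, hence `y₂ = δ y₁` (`exists_response_of_filtered`; both
sides solve the same linear differential equations).

It remains to see that `w = δ y` satisfies the constraint of `P₀` on `[0, T]`
(`integral_quadratic_filtered_nonneg`). By causality `y` can be replaced by zero after time `T`.
The constraint over `[0, ∞)` then follows from Plancherel's identity and the frequency domain
inequality, while the part of the integral over `(T, ∞)` is that of `r w² ≤ 0`.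

Plancherel's identity requires that the response of the minimal realization of `δ` decays after
time `T`. This holds because its state matrix is annihilated by the denominator of `δ`
(`aeval_denom_eq_zero_of_isMinimal`), whose roots lie in the open left half-plane
(`exists_norm_le_exp_of_aeval_eq_zero`).
-/

/-! ### Polynomial resolvent identities and minimal realizations -/

section Resolvent

open Polynomial

variable {ν : Type*} [Fintype ν] [DecidableEq ν]

/-- The polynomial vector `(sᵏ - Aᵏ) (s - A)⁻¹ b = ∑_{i + j = k - 1} sⁱ Aʲ b`. -/
noncomputable def resolventPow (A : Matrix ν ν ℝ) (b : ν → ℝ) : ℕ → ν → ℝ[X]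
  | 0 => 0
  | k + 1 => fun j => X * resolventPow A b k j + C ((A ^ k *ᵥ b) j)

/-- The polynomial vector `(g(s) - g(A)) (s - A)⁻¹ b`. -/
noncomputable def resolventNum (A : Matrix ν ν ℝ) (b : ν → ℝ) (g : ℝ[X]) (j : ν) : ℝ[X] :=
  g.sum fun k a => a • resolventPow A b k j

theorem resolventPow_mem_degreeLT (A : Matrix ν ν ℝ) (b : ν → ℝ) (k : ℕ) (j : ν) :
    resolventPow A b k j ∈ degreeLT ℝ k := by
  induction k with
  | zero => simp [resolventPow]
  | succ k ih =>
    rw [mem_degreeLT] at ih ⊢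
    refine (degree_add_le _ _).trans_lt (max_lt ?_ ?_)
    · rw [degree_mul, degree_X]
      rcases eq_or_ne (resolventPow A b k j) 0 with h | h
      · rw [h, degree_zero, WithBot.add_bot]; exact WithBot.bot_lt_coe _
      · rw [degree_eq_natDegree h] at ih ⊢
        norm_cast at ih ⊢
        omega
    · exact degree_C_le.trans_lt (by norm_cast; omega)

theorem resolventNum_mem_degreeLT (A : Matrix ν ν ℝ) (b : ν → ℝ) (g : ℝ[X]) (hg : g ≠ 0) (j : ν) :
    (resolventNum A b g j).degree < g.degree := by
  rw [degree_eq_natDegree hg, ← mem_degreeLT]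
  by_cases h0 : g.natDegree = 0
  · obtain ⟨a, rfl⟩ : ∃ a, g = C a := ⟨_, eq_C_of_natDegree_eq_zero h0⟩
    simp [resolventNum, sum_C_index, resolventPow]
  · refine Submodule.sum_mem _ fun k hk => Submodule.smul_mem _ _ ?_
    exact degreeLT_mono (le_natDegree_of_mem_supp k hk) (resolventPow_mem_degreeLT A b k j)

variable {S : Type*} [CommRing S] [Algebra ℝ S]

theorem pow_smul_eq_of_resolvent (A : Matrix ν ν ℝ) (b : ν → ℝ) (s y : S) (x : ν → S)
    (h : s • x = A.map (algebraMap ℝ S) *ᵥ x + y • fun j => algebraMap ℝ S (b j)) (k : ℕ) :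
    s ^ k • x = (A ^ k).map (algebraMap ℝ S) *ᵥ x +
      y • fun j => aeval s (resolventPow A b k j) := by
  have hpow (k : ℕ) : (A ^ k).map (algebraMap ℝ S) = (A.map (algebraMap ℝ S)) ^ k := by
    simpa using map_pow (algebraMap ℝ S).mapMatrix A k
  induction k with
  | zero =>
    ext j
    simp [resolventPow]
  | succ k ih =>
    have hb : (fun j => algebraMap ℝ S ((A ^ k *ᵥ b) j)) =
        (A ^ k).map (algebraMap ℝ S) *ᵥ fun j => algebraMap ℝ S (b j) := by
      ext j
      simp [mulVec, dotProduct, map_sum]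
    rw [pow_succ', mul_smul, ih, smul_add, ← mulVec_smul, h, mulVec_add, mulVec_mulVec,
      mulVec_smul, ← hb, hpow, hpow, ← pow_succ, add_assoc]
    congr 1
    ext j
    simp [resolventPow]
    ring

/-- If `(s - A) x = y b`, then `g(s) x = g(A) x + y (g(s) - g(A)) (s - A)⁻¹ b`, where the last
term is polynomial in `s`. -/
theorem aeval_smul_eq_of_resolvent (A : Matrix ν ν ℝ) (b : ν → ℝ) (s y : S) (x : ν → S)
    (h : s • x = A.map (algebraMap ℝ S) *ᵥ x + y • fun j => algebraMap ℝ S (b j)) (g : ℝ[X]) :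
    aeval s g • x = (aeval A g).map (algebraMap ℝ S) *ᵥ x +
      y • fun j => aeval s (resolventNum A b g j) := by
  induction g using Polynomial.induction_on' with
  | add p q hp hq =>
    have : ∀ j, resolventNum A b (p + q) j = resolventNum A b p j + resolventNum A b q j := by
      intro j
      exact sum_add_index _ _ _ (by simp) (by intro _ a b; exact add_smul a b _)
    simp only [this, map_add, add_smul, hp, hq]
    ext j
    simp [Matrix.map_add, add_mulVec]
    ring
  | monomial k a =>
    have : ∀ j, resolventNum A b (monomial k a) j = a • resolventPow A b k j := by
      intro j
      exact sum_monomial_index _ _ (by simp)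
    simp only [this, aeval_monomial, mul_smul, pow_smul_eq_of_resolvent A b s y x h]
    have ha : algebraMap ℝ (Matrix ν ν ℝ) a * A ^ k = a • A ^ k := (Algebra.smul_def a _).symm
    have hm : (a • A ^ k).map (algebraMap ℝ S) = algebraMap ℝ S a • (A ^ k).map (algebraMap ℝ S) := by
      ext; simp
    rw [ha, hm, smul_mulVec, smul_add]
    congr 1
    ext j
    simp [Algebra.smul_def, mul_left_comm]

theorem aeval_ratFunc_X (p : ℝ[X]) :
    aeval (RatFunc.X : RatFunc ℝ) p = algebraMap ℝ[X] (RatFunc ℝ) p := by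
  rw [← RatFunc.algebraMap_X, aeval_algebraMap_apply, aeval_X_left_apply]

theorem algebraMap_denom_mul (δ : RatFunc ℝ) :
    algebraMap ℝ[X] (RatFunc ℝ) δ.denom * δ = algebraMap ℝ[X] (RatFunc ℝ) δ.num := by
  have h0 : algebraMap ℝ[X] (RatFunc ℝ) δ.denom ≠ 0 :=
    (map_ne_zero_iff _ (IsFractionRing.injective ℝ[X] (RatFunc ℝ))).2 δ.denom_ne_zero
  rw [mul_comm, ← eq_div_iff h0, RatFunc.num_div_denom]

/-- The resolvent is strictly proper: a row vector `c` for which `c (s - A)⁻¹ b` is a polynomial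
annihilates `b, A b, A² b, …`. -/
theorem dotProduct_pow_mulVec_eq_zero_of_polynomial (A : Matrix ν ν ℝ) (b : ν → ℝ)
    (x : ν → RatFunc ℝ)
    (h : (RatFunc.X : RatFunc ℝ) • x = A.map (algebraMap ℝ (RatFunc ℝ)) *ᵥ x +
      (1 : RatFunc ℝ) • fun j => algebraMap ℝ (RatFunc ℝ) (b j))
    (m : ℕ) (c : ν → ℝ) (π : ℝ[X])
    (hc : (fun j => algebraMap ℝ (RatFunc ℝ) (c j)) ⬝ᵥ x = algebraMap ℝ[X] (RatFunc ℝ) π) :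
    c ⬝ᵥ (A ^ m *ᵥ b) = 0 := by
  have hX := aeval_ratFunc_X
  have key : ∀ (c : ν → ℝ) (π : ℝ[X]),
      (fun j => algebraMap ℝ (RatFunc ℝ) (c j)) ⬝ᵥ x = algebraMap ℝ[X] (RatFunc ℝ) π → π = 0 := by
    intro c π hc
    have h1 := aeval_smul_eq_of_resolvent A b _ _ x h A.charpoly
    rw [aeval_self_charpoly, hX] at h1
    have h2 := congrArg (fun v => (fun j => algebraMap ℝ (RatFunc ℝ) (c j)) ⬝ᵥ v) h1
    simp only [dotProduct_smul, hc, one_smul, hX] at h2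
    have h3 : A.charpoly * π = ∑ j, c j • resolventNum A b A.charpoly j := by
      apply IsFractionRing.injective ℝ[X] (RatFunc ℝ)
      rw [map_mul, ← smul_eq_mul, h2]
      simp [dotProduct, Algebra.smul_def]
    by_contra hπ
    have h4 : (A.charpoly * π).degree < A.charpoly.degree := by
      rw [h3, degree_eq_natDegree A.charpoly_monic.ne_zero, ← mem_degreeLT]
      refine Submodule.sum_mem _ fun k _ => Submodule.smul_mem _ _ ?_
      rw [mem_degreeLT, ← degree_eq_natDegree A.charpoly_monic.ne_zero]
      exact resolventNum_mem_degreeLT A b _ A.charpoly_monic.ne_zero k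
    rw [degree_mul, degree_eq_natDegree A.charpoly_monic.ne_zero,
      degree_eq_natDegree hπ] at h4
    norm_cast at h4
    omega
  -- `c A x = s c x - c b` is again a polynomial, hence zero.
  have step : ∀ (c : ν → ℝ) (π : ℝ[X]),
      (fun j => algebraMap ℝ (RatFunc ℝ) (c j)) ⬝ᵥ x = algebraMap ℝ[X] (RatFunc ℝ) π →
      (fun j => algebraMap ℝ (RatFunc ℝ) ((c ᵥ* A) j)) ⬝ᵥ x =
        algebraMap ℝ[X] (RatFunc ℝ) (C (-(c ⬝ᵥ b))) := by
    intro c π hc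
    have hπ := key c π hc
    subst hπ
    have h1 := congrArg (fun v => (fun j => algebraMap ℝ (RatFunc ℝ) (c j)) ⬝ᵥ v) h
    simp only [dotProduct_smul, hc, dotProduct_add, one_smul, map_zero, smul_zero,
      dotProduct_mulVec] at h1
    have h2 : (fun j => algebraMap ℝ (RatFunc ℝ) (c j)) ⬝ᵥ (fun j => algebraMap ℝ (RatFunc ℝ) (b j))
        = algebraMap ℝ (RatFunc ℝ) (c ⬝ᵥ b) := by simp [dotProduct]
    have h3 : (fun j => algebraMap ℝ (RatFunc ℝ) (c j)) ᵥ* A.map (algebraMap ℝ (RatFunc ℝ)) =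
        fun j => algebraMap ℝ (RatFunc ℝ) ((c ᵥ* A) j) := by
      ext j; simp [vecMul, dotProduct]
    rw [h2, h3] at h1
    rw [eq_neg_of_add_eq_zero_left h1.symm, ← Polynomial.algebraMap_eq,
      ← IsScalarTower.algebraMap_apply, map_neg]
  induction m generalizing c π with
  | zero => simpa using key _ _ (step c π hc)
  | succ m ih => rw [pow_succ', ← mulVec_mulVec, dotProduct_mulVec, ih _ _ (step c π hc)]

theorem isUnit_X_smul_one_sub (A : Matrix ν ν ℝ) :
    IsUnit ((RatFunc.X : RatFunc ℝ) • (1 : Matrix ν ν (RatFunc ℝ)) - A.map RatFunc.C).det := by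
  have h : (RatFunc.X : RatFunc ℝ) • (1 : Matrix ν ν (RatFunc ℝ)) - A.map RatFunc.C =
      (charmatrix A).map (algebraMap ℝ[X] (RatFunc ℝ)) := by
    ext i j
    by_cases hij : i = j
    · subst hij; simp [charmatrix, RatFunc.algebraMap_X]
    · simp [charmatrix, hij]
  rw [h, isUnit_iff_ne_zero]
  have h2 : ((charmatrix A).map (algebraMap ℝ[X] (RatFunc ℝ))).det =
      algebraMap ℝ[X] (RatFunc ℝ) A.charpoly := by
    rw [Matrix.charpoly, RingHom.map_det]; rfl
  rw [h2]
  exact (map_ne_zero_iff _ (IsFractionRing.injective ℝ[X] (RatFunc ℝ))).2 A.charpoly_monic.ne_zero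

variable (sys : StateSpace ν (Fin 1) (Fin 1)) (δ : RatFunc ℝ)

theorem exists_resolvent_of_transferMatrix (h : sys.transferMatrix = !![δ]) :
    ∃ x : ν → RatFunc ℝ,
      (RatFunc.X : RatFunc ℝ) • x = sys.A.map (algebraMap ℝ (RatFunc ℝ)) *ᵥ x +
        (1 : RatFunc ℝ) • (fun j => algebraMap ℝ (RatFunc ℝ) (sys.B j 0)) ∧
      (fun j => algebraMap ℝ (RatFunc ℝ) (sys.C 0 j)) ⬝ᵥ x +
        algebraMap ℝ (RatFunc ℝ) (sys.D 0 0) = δ := by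
  have hu := isUnit_X_smul_one_sub sys.A
  set R := (RatFunc.X : RatFunc ℝ) • (1 : Matrix ν ν (RatFunc ℝ)) - sys.A.map RatFunc.C with hR
  refine ⟨(R⁻¹ * sys.B.map RatFunc.C).col 0, ?_, ?_⟩
  · have h1 : R *ᵥ (R⁻¹ * sys.B.map RatFunc.C).col 0 = (sys.B.map RatFunc.C).col 0 := by
      rw [← Matrix.mul_nonsing_inv_cancel_left R (sys.B.map RatFunc.C) hu]
      rw [Matrix.nonsing_inv_mul_cancel_left R _ hu]
      ext i; simp [mulVec, dotProduct, Matrix.mul_apply]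
    rw [hR, sub_mulVec, smul_mulVec, one_mulVec, ← hR, sub_eq_iff_eq_add'] at h1
    rw [one_smul]
    exact h1
  · have h1 := congrFun (congrFun h 0) 0
    simp only [StateSpace.transferMatrix, ← hR] at h1
    rw [Matrix.mul_assoc] at h1
    simpa [Matrix.mul_apply, dotProduct] using h1

/-- The state matrix of a minimal realization is annihilated by the denominator of the transfer
function. -/
theorem aeval_denom_eq_zero_of_isMinimal (hmin : sys.IsMinimal) (h : sys.transferMatrix = !![δ]) :
    aeval sys.A δ.denom = 0 := by
  obtain ⟨x, hx, hδ⟩ := exists_resolvent_of_transferMatrix sys δ h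
  set b : ν → ℝ := fun j => sys.B j 0 with hb
  have hX := aeval_ratFunc_X
  have hd := algebraMap_denom_mul δ
  -- `C d(A) (s - A)⁻¹ b` is a polynomial since `d δ` is one.
  have hpoly : (fun j => algebraMap ℝ (RatFunc ℝ) ((sys.C.row 0 ᵥ* aeval sys.A δ.denom) j)) ⬝ᵥ x =
      algebraMap ℝ[X] (RatFunc ℝ) (δ.num - C (sys.D 0 0) * δ.denom -
        ∑ j, C (sys.C 0 j) * resolventNum sys.A b δ.denom j) := by
    have h1 := aeval_smul_eq_of_resolvent sys.A b _ _ x hx δ.denom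
    have h2 := congrArg (fun v => (fun j => algebraMap ℝ (RatFunc ℝ) (sys.C 0 j)) ⬝ᵥ v) h1
    have h3 : (fun j => algebraMap ℝ (RatFunc ℝ) ((sys.C.row 0 ᵥ* aeval sys.A δ.denom) j)) =
        (fun j => algebraMap ℝ (RatFunc ℝ) (sys.C 0 j)) ᵥ*
          (aeval sys.A δ.denom).map (algebraMap ℝ (RatFunc ℝ)) := by
      ext j; simp [vecMul, dotProduct]
    simp only [dotProduct_smul, dotProduct_add, one_smul, hX, smul_eq_mul,
      eq_sub_of_add_eq hδ, mul_sub, hd] at h2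
    rw [h3, ← dotProduct_mulVec, eq_sub_of_add_eq h2.symm]
    simp [dotProduct, mul_comm]
  have hz : ∀ m, (sys.C.row 0 ᵥ* aeval sys.A δ.denom) ⬝ᵥ (sys.A ^ m *ᵥ b) = 0 := fun m =>
    dotProduct_pow_mulVec_eq_zero_of_polynomial sys.A b x hx m _ _ hpoly
  have hzero : ∀ v ∈ Submodule.span ℝ {v : ν → ℝ | ∃ (i : ℕ) (u : Fin 1 → ℝ),
      v = sys.A ^ i *ᵥ (sys.B *ᵥ u)}, aeval sys.A δ.denom *ᵥ v = 0 := by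
    intro v hv
    induction hv using Submodule.span_induction with
    | zero => simp
    | add v w _ _ hv hw => rw [mulVec_add, hv, hw, add_zero]
    | smul a v _ hv => rw [mulVec_smul, hv, smul_zero]
    | mem v hv =>
      obtain ⟨i, u, rfl⟩ := hv
      have hu : sys.B *ᵥ u = u 0 • b := by
        ext j; simp [mulVec, dotProduct, hb, mul_comm]
      rw [hu, mulVec_smul, mulVec_smul]
      suffices aeval sys.A δ.denom *ᵥ sys.A ^ i *ᵥ b = 0 by rw [this, smul_zero]
      refine hmin.2 _ fun k => ?_
      ext r
      have hcomm : sys.A ^ k * aeval sys.A δ.denom = aeval sys.A δ.denom * sys.A ^ k := by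
        rw [← aeval_X_pow (R := ℝ) sys.A, ← map_mul, mul_comm, map_mul]
      have := hz (k + i)
      rw [pow_add, ← mulVec_mulVec, ← dotProduct_mulVec, mulVec_mulVec, ← hcomm,
        ← mulVec_mulVec] at this
      rw [Subsingleton.elim r 0]
      exact this
  ext i j
  have := congrFun (hzero (Pi.single j 1) (by
    rw [show Submodule.span ℝ _ = _ from hmin.1]; trivial)) i
  simpa using this

/-- In the frequency domain a minimal realization acts as multiplication by its transfer
function. -/
theorem denom_mul_output_eq (hmin : sys.IsMinimal) (h : sys.transferMatrix = !![δ]) (s y : ℂ)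
    (v : ν → ℂ) (hv : s • v = sys.A.map (algebraMap ℝ ℂ) *ᵥ v +
      y • fun j => algebraMap ℝ ℂ (sys.B j 0)) :
    aeval s δ.denom * ((fun j => algebraMap ℝ ℂ (sys.C 0 j)) ⬝ᵥ v + sys.D 0 0 * y) =
      aeval s δ.num * y := by
  have hA := aeval_denom_eq_zero_of_isMinimal sys δ hmin h
  obtain ⟨x, hx, hδ⟩ := exists_resolvent_of_transferMatrix sys δ h
  have hX := aeval_ratFunc_X
  have hd := algebraMap_denom_mul δ
  have hnum : δ.num = ∑ j, C (sys.C 0 j) * resolventNum sys.A (fun j => sys.B j 0) δ.denom j +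
      δ.denom * C (sys.D 0 0) := by
    apply IsFractionRing.injective ℝ[X] (RatFunc ℝ)
    have h1 := aeval_smul_eq_of_resolvent sys.A _ _ _ x hx δ.denom
    have h2 := congrArg (fun v => (fun j => algebraMap ℝ (RatFunc ℝ) (sys.C 0 j)) ⬝ᵥ v) h1
    simp only [hA, dotProduct_smul, dotProduct_add, one_smul, hX, smul_eq_mul,
      eq_sub_of_add_eq hδ, mul_sub, hd] at h2
    rw [sub_eq_iff_eq_add] at h2
    rw [h2]
    simp [dotProduct]
  have h1 := aeval_smul_eq_of_resolvent sys.A _ _ _ v hv δ.denom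
  have h2 := congrArg (fun v => (fun j => algebraMap ℝ ℂ (sys.C 0 j)) ⬝ᵥ v) h1
  simp only [hA, dotProduct_smul, dotProduct_add, smul_eq_mul] at h2
  rw [mul_add, h2, hnum]
  simp [dotProduct, mul_comm, Finset.mul_sum, mul_add]
  ring

end Resolvent

/-! ### Exponential decay of stable linear systems -/

section Decay

open Polynomial

/-- Variation of constants for `u' = a u + f`: exponential decay of the forcing term at a rate that
is slower than that of `exp (a t)` is inherited by `u`. -/
theorem exists_norm_le_exp_of_forced {V : Type*} [NormedAddCommGroup V] [NormedSpace ℂ V]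
    {a : ℂ} {ε C : ℝ} (ha : a.re < -ε) (hC : 0 ≤ C) {u f : ℝ → V} (hu : ContinuousOn u (Ici 0))
    (hu' : ∀ t, 0 ≤ t → HasDerivWithinAt u (a • u t + f t) (Ici t) t)
    (hf : ∀ t, 0 ≤ t → ‖f t‖ ≤ C * Real.exp (-ε * t)) :
    ∃ C', 0 ≤ C' ∧ ∀ t, 0 ≤ t → ‖u t‖ ≤ C' * Real.exp (-ε * t) := by
  set r : ℝ := -a.re - ε with hr
  have hr0 : 0 < r := by linarith
  refine ⟨C / r + ‖u 0‖, by positivity, fun t ht => ?_⟩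
  have hexp (t : ℝ) : ‖Complex.exp (-a * t)‖ = Real.exp (-a.re * t) := by
    simp [Complex.norm_exp]
  have hd (t : ℝ) :
      HasDerivAt (fun t : ℝ => Complex.exp (-a * t)) (Complex.exp (-a * t) * (-a)) t := by
    have h1 : HasDerivAt (fun t : ℝ => -a * (t : ℂ)) (-a) t := by
      simpa using (Complex.ofRealCLM.hasDerivAt (x := t)).const_mul (-a)
    exact h1.cexp
  have hg' : ∀ s ∈ Ico 0 t, HasDerivWithinAt (fun t : ℝ => Complex.exp (-a * t) • u t)
      (Complex.exp (-a * s) • f s) (Ici s) s := by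
    intro s hs
    convert! (hd s).hasDerivWithinAt.smul (hu' s hs.1) using 1
    rw [smul_add, smul_smul, add_right_comm, ← add_smul]
    simp
  have hB (s : ℝ) : HasDerivAt (fun s : ℝ => C / r * Real.exp (r * s) + ‖u 0‖)
      (C * Real.exp (r * s)) s := by
    have h1 : HasDerivAt (fun s : ℝ => r * s) r s := by simpa using (hasDerivAt_id s).const_mul r
    convert! (h1.exp.const_mul (C / r)).add_const _ using 1
    field_simp
  have key := image_norm_le_of_norm_deriv_right_le_deriv_boundary (a := 0) (b := t)
    (f := fun t : ℝ => Complex.exp (-a * t) • u t)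
    (by
      refine ContinuousOn.smul ?_ (hu.mono Icc_subset_Ici_self)
      fun_prop) hg'
    (by simp; positivity) hB
    (by
      intro s hs
      rw [norm_smul, hexp]
      calc _ ≤ Real.exp (-a.re * s) * (C * Real.exp (-ε * s)) := by gcongr; exact hf s hs.1
        _ = C * Real.exp (r * s) := by
          rw [mul_left_comm, ← Real.exp_add]; congr 2; rw [hr]; ring) ⟨ht, le_rfl⟩
  simp only [norm_smul, hexp] at key
  have h2 : ‖u t‖ = Real.exp (a.re * t) * (Real.exp (-a.re * t) * ‖u t‖) := by
    rw [← mul_assoc, ← Real.exp_add]; simp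
  rw [h2]
  calc _ ≤ Real.exp (a.re * t) * (C / r * Real.exp (r * t) + ‖u 0‖) := by gcongr
    _ = C / r * Real.exp (-ε * t) + Real.exp (a.re * t) * ‖u 0‖ := by
      rw [mul_add, mul_left_comm, ← Real.exp_add]; congr 3; rw [hr]; ring
    _ ≤ C / r * Real.exp (-ε * t) + Real.exp (-ε * t) * ‖u 0‖ := by gcongr
    _ = _ := by ring

variable {ν : Type*} [Fintype ν]

theorem HasDerivWithinAt.matrix_mulVec {𝕜 κ : Type*} [RCLike 𝕜] [Fintype κ] (A : Matrix κ ν 𝕜)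
    {u : ℝ → ν → 𝕜} {u' : ν → 𝕜} {s : Set ℝ} {t : ℝ} (h : HasDerivWithinAt u u' s t) :
    HasDerivWithinAt (fun t => A *ᵥ u t) (A *ᵥ u') s t := by
  rw [hasDerivWithinAt_pi] at h ⊢
  intro i
  simp only [mulVec, dotProduct]
  exact HasDerivWithinAt.fun_sum fun j _ => (h j).const_mul _

theorem ContinuousOn.matrix_mulVec_const {𝕜 κ : Type*} [RCLike 𝕜] (A : Matrix κ ν 𝕜)
    {u : ℝ → ν → 𝕜} {s : Set ℝ} (h : ContinuousOn u s) :
    ContinuousOn (fun t => A *ᵥ u t) s := by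
  rw [continuousOn_pi] at h ⊢
  intro i
  simp only [mulVec, dotProduct]
  exact continuousOn_finsetSum _ fun j _ => continuousOn_const.mul (h j)

variable [DecidableEq ν]

/-- Induction on the number of factors: `(A - a) u` solves the same equation as `u` and is
annihilated by the remaining factors. -/
theorem exists_norm_le_exp_of_aeval_prod (A : Matrix ν ν ℂ) {ε : ℝ} (s : Multiset ℂ)
    (hs : ∀ a ∈ s, a.re < -ε) (u : ℝ → ν → ℂ) (hu : ContinuousOn u (Ici 0))
    (hu' : ∀ t, 0 ≤ t → HasDerivWithinAt u (A *ᵥ u t) (Ici t) t)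
    (h0 : ∀ t, 0 ≤ t → aeval A (s.map fun a => X - C a).prod *ᵥ u t = 0) :
    ∃ C, 0 ≤ C ∧ ∀ t, 0 ≤ t → ‖u t‖ ≤ C * Real.exp (-ε * t) := by
  induction s using Multiset.induction_on generalizing u with
  | empty =>
    refine ⟨0, le_rfl, fun t ht => ?_⟩
    have := h0 t ht
    simp at this
    simp [this]
  | cons a s ih =>
    obtain ⟨C, hC, hf⟩ := ih (fun b hb => hs b (Multiset.mem_cons_of_mem hb))
      (fun t => (A - algebraMap ℂ _ a) *ᵥ u t) (hu.matrix_mulVec_const _)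
      (fun t ht => by
        have := (hu' t ht).matrix_mulVec (A - algebraMap ℂ _ a)
        convert! this using 1
        rw [mulVec_mulVec, mulVec_mulVec, mul_sub, sub_mul, Algebra.commutes])
      (fun t ht => by
        have := h0 t ht
        rw [Multiset.map_cons, Multiset.prod_cons, mul_comm, map_mul, ← mulVec_mulVec] at this
        simpa using this)
    refine exists_norm_le_exp_of_forced (hs a (Multiset.mem_cons_self a s)) hC hu (fun t ht => ?_) hf
    convert! hu' t ht using 1
    simp [sub_mulVec, Algebra.algebraMap_eq_smul_one, smul_mulVec]

/-- Solutions of `x' = A x` decay exponentially if `A` is annihilated by a monic polynomial with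
all roots in the open left half-plane. -/
theorem exists_norm_le_exp_of_aeval_eq_zero (A : Matrix ν ν ℝ) (d : ℝ[X]) (hd : d.Monic)
    (hstab : ∀ s : ℂ, aeval s d = 0 → s.re < 0) (hA : aeval A d = 0)
    (x : ℝ → ν → ℝ) (hx : ContinuousOn x (Ici 0))
    (hx' : ∀ t, 0 ≤ t → HasDerivWithinAt x (A *ᵥ x t) (Ici t) t) :
    ∃ C ε, 0 ≤ C ∧ 0 < ε ∧ ∀ t, 0 ≤ t → ‖x t‖ ≤ C * Real.exp (-ε * t) := by
  set s := (d.map (algebraMap ℝ ℂ)).roots with hs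
  obtain ⟨ε, hε, hsε⟩ : ∃ ε > 0, ∀ a ∈ s, a.re < -ε := by
    have hneg : ∀ a ∈ s, a.re < 0 := by
      intro a ha
      apply hstab
      rw [hs, mem_roots'] at ha
      simpa [aeval_def, eval_map, IsRoot] using ha.2
    clear_value s
    clear hs
    induction s using Multiset.induction_on with
    | empty => exact ⟨1, one_pos, by simp⟩
    | cons b s ih =>
      obtain ⟨ε, hε, h⟩ := ih fun a ha => hneg a (Multiset.mem_cons_of_mem ha)
      have hb := hneg b (Multiset.mem_cons_self b s)
      refine ⟨min ε (-b.re / 2), lt_min hε (by linarith), fun a ha => ?_⟩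
      rcases Multiset.mem_cons.1 ha with rfl | ha
      · have := min_le_right ε (-a.re / 2); linarith
      · have := min_le_left ε (-b.re / 2); linarith [h a ha]
  have hprod : (s.map fun a => X - C a).prod = d.map (algebraMap ℝ ℂ) := by
    have := (IsAlgClosed.splits (d.map (algebraMap ℝ ℂ))).eq_prod_roots
    rw [(hd.map _).leadingCoeff, C_1, one_mul] at this
    exact this.symm
  have hAC : aeval (A.map (algebraMap ℝ ℂ)) (d.map (algebraMap ℝ ℂ)) = 0 := by
    rw [aeval_map_algebraMap]
    have := aeval_algHom_apply (Algebra.ofId ℝ ℂ).mapMatrix A d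
    rw [hA, map_zero] at this
    exact this
  obtain ⟨C, hC, h⟩ := exists_norm_le_exp_of_aeval_prod (A.map (algebraMap ℝ ℂ)) s hsε
    (fun t j => (x t j : ℂ))
    (by
      rw [continuousOn_pi] at hx ⊢
      exact fun j => Complex.continuous_ofReal.comp_continuousOn (hx j))
    (fun t ht => by
      have := hx' t ht
      rw [hasDerivWithinAt_pi] at this ⊢
      intro j
      convert! (this j).ofReal_comp using 1
      simp [mulVec, dotProduct])
    (fun t _ => by rw [hprod, hAC, zero_mulVec])
  refine ⟨C, ε, hC, hε, fun t ht => ?_⟩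
  have h1 := h t ht
  rw [pi_norm_le_iff_of_nonneg (by positivity)] at h1 ⊢
  intro j
  simpa using h1 j

/-- Linear differential equations with continuous forcing have global solutions. -/
theorem exists_hasDerivAt_linear (A : Matrix ν ν ℝ) (g : ℝ → ν → ℝ) (hg : Continuous g) (T : ℝ)
    (x₀ : ν → ℝ) : ∃ x : ℝ → ν → ℝ, x T = x₀ ∧ ∀ t, HasDerivAt x (A *ᵥ x t + g t) t := by
  set L : (ν → ℝ) →L[ℝ] (ν → ℝ) := (toLin' A).toContinuousLinearMap with hL
  have hLA (v : ν → ℝ) : L v = A *ᵥ v := by simp [hL]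
  set Φ : ℝ → (ν → ℝ) →L[ℝ] (ν → ℝ) := fun t => NormedSpace.exp (t • L) with hΦ
  have hΦd (t : ℝ) : HasDerivAt Φ (L * Φ t) t := hasDerivAt_exp_smul_const' L t
  have hΦc : Continuous Φ := continuous_iff_continuousAt.2 fun t => (hΦd t).continuousAt
  have hinv (t : ℝ) (v : ν → ℝ) : Φ t (Φ (-t) v) = v := by
    have : Φ t * Φ (-t) = 1 := by
      let _ := NormedAlgebra.restrictScalars ℚ ℝ ((ν → ℝ) →L[ℝ] (ν → ℝ))
      have h1 := NormedSpace.exp_add_of_commute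
        (((Commute.refl L).smul_left t).smul_right (-t))
      rw [← add_smul, add_neg_cancel, zero_smul, NormedSpace.exp_zero] at h1
      exact h1.symm
    exact congrArg (fun M => M v) this
  have hc : Continuous fun s => Φ (-s) (g s) := (hΦc.comp continuous_neg).clm_apply hg
  refine ⟨fun t => Φ t (Φ (-T) x₀ + ∫ s in T..t, Φ (-s) (g s)), ?_, fun t => ?_⟩
  · simp [hinv]
  · have h1 := (hΦd t).clm_apply
      ((intervalIntegral.integral_hasDerivAt_right (hc.intervalIntegrable T t)
        (hc.stronglyMeasurableAtFilter _ _) hc.continuousAt).const_add (Φ (-T) x₀))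
    rw [hinv, mul_apply_eq_comp, hLA] at h1
    exact h1

end Decay

/-! ### Plancherel's identity for integrable square-integrable functions -/

section Plancherel

open MeasureTheory FourierTransform SchwartzMap

/-- The `L²` Fourier transform of an integrable function is given by the Fourier integral. -/
theorem fourier_toLp_ae_eq (f : ℝ → ℂ) (hf1 : Integrable f) (hf2 : MemLp f 2) :
    (𝓕 (hf2.toLp f) : Lp ℂ 2 (volume : Measure ℝ)) =ᵐ[volume] 𝓕 f := by
  have hcont : Continuous (𝓕 f) :=
    VectorFourier.fourierIntegral_continuous Real.continuous_fourierChar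
      (by exact continuous_inner) hf1
  refine ae_eq_of_integral_contDiff_smul_eq
    ((Lp.memLp _).locallyIntegrable (by norm_num)) hcont.locallyIntegrable ?_
  intro g hg hgc
  -- Test against the Schwartz function `φ = g` and move the Fourier transform onto `φ`.
  set φ : 𝓢(ℝ, ℂ) := (hgc.comp_left (g := Complex.ofReal) rfl).toSchwartzMap
    (Complex.ofRealCLM.contDiff.comp hg) with hφ
  have hφg (t : ℝ) : φ t = (g t : ℂ) := rfl
  have h1 := congrArg (fun T => T φ) (Lp.fourier_toTemperedDistribution_eq (hf2.toLp f))
  simp only [TemperedDistribution.fourier_apply, Lp.toTemperedDistribution_apply, hφg] at h1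
  have h2 : ∫ x, (𝓕 φ) x • hf2.toLp f x = ∫ x, f x * 𝓕 (φ : ℝ → ℂ) x := by
    apply integral_congr_ae
    filter_upwards [hf2.coeFn_toLp] with x hx
    rw [hx, smul_eq_mul, mul_comm, SchwartzMap.fourier_coe]
  have h3 : ∫ x, 𝓕 f x * φ x = ∫ x, f x * 𝓕 (φ : ℝ → ℂ) x := by
    simpa using! VectorFourier.integral_fourierIntegral_smul_eq_flip (L := innerₗ ℝ)
      Real.continuous_fourierChar continuous_inner hf1 (φ.integrable (μ := volume))
  calc _ = ∫ x, (g x : ℂ) • (𝓕 (hf2.toLp f) : Lp ℂ 2 (volume : Measure ℝ)) x := by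
        simp [Complex.real_smul]
    _ = ∫ x, 𝓕 f x * φ x := by rw [← h1, h2, h3]
    _ = _ := by simp [hφg, Complex.real_smul, mul_comm]

/-- Plancherel's identity with the Fourier transform given by the Fourier integral. -/
theorem integral_conj_fourier_mul_fourier (f g : ℝ → ℂ) (hf1 : Integrable f) (hf2 : MemLp f 2)
    (hg1 : Integrable g) (hg2 : MemLp g 2) :
    ∫ ξ, starRingEnd ℂ (𝓕 f ξ) * 𝓕 g ξ = ∫ t, starRingEnd ℂ (f t) * g t := by
  have h := Lp.inner_fourier_eq (hf2.toLp f) (hg2.toLp g)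
  rw [L2.inner_def, L2.inner_def] at h
  have h1 : ∫ ξ, inner ℂ ((𝓕 (hf2.toLp f) : Lp ℂ 2 (volume : Measure ℝ)) ξ)
      ((𝓕 (hg2.toLp g) : Lp ℂ 2 (volume : Measure ℝ)) ξ) = ∫ ξ, starRingEnd ℂ (𝓕 f ξ) * 𝓕 g ξ := by
    apply integral_congr_ae
    filter_upwards [fourier_toLp_ae_eq f hf1 hf2, fourier_toLp_ae_eq g hg1 hg2] with ξ h1 h2
    rw [h1, h2, RCLike.inner_apply, mul_comm]
  have h2 : ∫ ξ, inner ℂ (hf2.toLp f ξ) (hg2.toLp g ξ) = ∫ ξ, starRingEnd ℂ (f ξ) * g ξ := by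
    apply integral_congr_ae
    filter_upwards [hf2.coeFn_toLp, hg2.coeFn_toLp] with ξ h1 h2
    rw [h1, h2, RCLike.inner_apply, mul_comm]
  rw [← h1, ← h2, h]

theorem memLp_two_fourier (f : ℝ → ℂ) (hf1 : Integrable f) (hf2 : MemLp f 2) :
    MemLp (𝓕 f) 2 :=
  (memLp_congr_ae (fourier_toLp_ae_eq f hf1 hf2)).1 (Lp.memLp _)

end Plancherel

/-! ### The frequency domain inequality and truncated inputs -/

section Dissipation

open MeasureTheory FourierTransform Polynomial

theorem integral_add_add {α E : Type*} [MeasurableSpace α] {μ : Measure α} [NormedAddCommGroup E]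
    [NormedSpace ℝ E] {a b c : α → E} (ha : Integrable a μ) (hb : Integrable b μ)
    (hc : Integrable c μ) :
    ∫ t, (a t + b t + c t) ∂μ = ∫ t, a t ∂μ + ∫ t, b t ∂μ + ∫ t, c t ∂μ := by
  rw [← integral_add ha hb]
  exact integral_add (ha.add hb) hc

/-- A pointwise quadratic inequality between Fourier transforms integrates to a quadratic
inequality between the functions. -/
theorem integral_quadratic_nonneg_of_fourier (q s r : ℝ) (f g : ℝ → ℝ)
    (hf1 : Integrable f) (hf2 : MemLp f 2) (hg1 : Integrable g) (hg2 : MemLp g 2)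
    (d : ℝ → ℂ) (hd : ∀ ξ, 𝓕 (fun t => (g t : ℂ)) ξ = d ξ * 𝓕 (fun t => (f t : ℂ)) ξ)
    (hnn : ∀ ξ, 0 ≤ q + 2 * s * (d ξ).re + r * Complex.normSq (d ξ)) :
    0 ≤ ∫ t, (q * f t ^ 2 + 2 * s * (f t * g t) + r * g t ^ 2) := by
  set F := 𝓕 (fun t => (f t : ℂ)) with hF
  set G := 𝓕 (fun t => (g t : ℂ)) with hG
  have hF2 : MemLp F 2 := memLp_two_fourier _ hf1.ofReal hf2.ofReal
  have hG2 : MemLp G 2 := memLp_two_fourier _ hg1.ofReal hg2.ofReal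
  have hff := integral_conj_fourier_mul_fourier _ _ hf1.ofReal hf2.ofReal hf1.ofReal hf2.ofReal
  have hfg := integral_conj_fourier_mul_fourier _ _ hf1.ofReal hf2.ofReal hg1.ofReal hg2.ofReal
  have hgg := integral_conj_fourier_mul_fourier _ _ hg1.ofReal hg2.ofReal hg1.ofReal hg2.ofReal
  have real (a b : ℝ → ℝ) : ∫ t, starRingEnd ℂ ((a t : ℝ) : ℂ) * ((b t : ℝ) : ℂ) =
      ((∫ t, a t * b t : ℝ) : ℂ) := by
    rw [← integral_complex_ofReal]; simp
  have hre (a b : ℝ → ℂ) (ha : MemLp a 2) (hb : MemLp b 2) :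
      Integrable (fun t => starRingEnd ℂ (a t) * b t) := ha.star.integrable_mul hb
  simp only [RCLike.ofReal_eq_complex_ofReal, ← hF, ← hG, real] at hff hfg hgg
  have e (a b : ℝ → ℂ) (ha : MemLp a 2) (hb : MemLp b 2) (c : ℝ)
      (h : ∫ t, starRingEnd ℂ (a t) * b t = (c : ℂ)) :
      c = ∫ t, (starRingEnd ℂ (a t) * b t).re := by
    have := integral_re (hre a b ha hb)
    simp only [RCLike.re_to_complex] at this
    rw [this, h, Complex.ofReal_re]
  have i1 : Integrable fun t => (starRingEnd ℂ (F t) * F t).re := (hre F F hF2 hF2).re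
  have i2 : Integrable fun t => (starRingEnd ℂ (F t) * G t).re := (hre F G hF2 hG2).re
  have i3 : Integrable fun t => (starRingEnd ℂ (G t) * G t).re := (hre G G hG2 hG2).re
  have j1 : Integrable fun t => f t ^ 2 := hf2.integrable_sq
  have j2 : Integrable fun t => f t * g t := hf2.integrable_mul hg2
  have j3 : Integrable fun t => g t ^ 2 := hg2.integrable_sq
  have lin (a b c : ℝ → ℝ) (ha : Integrable a) (hb : Integrable b) (hc : Integrable c) :
      ∫ t, (q * a t + 2 * s * b t + r * c t) =
        q * (∫ t, a t) + 2 * s * (∫ t, b t) + r * ∫ t, c t := by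
    rw [integral_add_add (ha.const_mul q) (hb.const_mul _) (hc.const_mul r), integral_const_mul,
      integral_const_mul, integral_const_mul]
  rw [lin _ _ _ j1 j2 j3]
  simp only [sq]
  rw [e F F hF2 hF2 _ hff, e F G hF2 hG2 _ hfg, e G G hG2 hG2 _ hgg, ← lin _ _ _ i1 i2 i3]
  refine integral_nonneg fun ξ => ?_
  have h := mul_nonneg (hnn ξ) (Complex.normSq_nonneg (F ξ))
  refine h.trans_eq ?_
  simp only [show G ξ = d ξ * F ξ from hd ξ]
  simp [Complex.normSq_apply]
  ring

variable {ν : Type*} [Fintype ν]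

theorem integrableOn_mulVec_apply {κ : Type*} (A : Matrix κ ν ℝ) {S : Set ℝ} {u : ℝ → ν → ℝ}
    (hu : ∀ j, IntegrableOn (fun t => u t j) S) (k : κ) :
    IntegrableOn (fun t => (A *ᵥ u t) k) S := by
  simp only [mulVec, dotProduct]
  exact integrable_finsetSum _ fun j _ => (hu j).const_mul _

/-- The Laplace transform of a trajectory that is driven by `y` up to time `T` and unforced
thereafter. -/
theorem laplace_truncated_response (A : Matrix ν ν ℝ) (b : ν → ℝ) {T : ℝ} (hT : 0 ≤ T)
    (X Y : ℝ → ν → ℝ) (y : ℝ → ℝ) (hX0 : X 0 = 0) (hX : ContinuousOn X (Ici 0))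
    (hX' : ∀ t, 0 ≤ t → HasDerivWithinAt X (A *ᵥ X t + y t • b) (Ici t) t)
    (hy : IntegrableOn y (Ioc 0 T)) (hYT : Y T = X T)
    (hY' : ∀ t, HasDerivAt Y (A *ᵥ Y t) t)
    (hYi : ∀ j, IntegrableOn (fun t => Y t j) (Ioi T)) (hYlim : Tendsto Y atTop (𝓝 0))
    (s : ℂ) (hs : s.re = 0) (v : ν → ℂ)
    (hv : ∀ j, v j = (∫ t in Ioc 0 T, Complex.exp (-s * t) * (X t j : ℂ)) +
      ∫ t in Ioi T, Complex.exp (-s * t) * (Y t j : ℂ)) :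
    s • v = A.map (algebraMap ℝ ℂ) *ᵥ v +
      (∫ t in Ioc 0 T, Complex.exp (-s * t) * (y t : ℂ)) • fun j => algebraMap ℝ ℂ (b j) := by
  have hnorm (t : ℝ) : ‖Complex.exp (-s * t)‖ = 1 := by simp [Complex.norm_exp, hs]
  have hexpc : Continuous fun t : ℝ => Complex.exp (-s * t) := by fun_prop
  have hd (t : ℝ) :
      HasDerivAt (fun t : ℝ => Complex.exp (-s * t)) (Complex.exp (-s * t) * (-s)) t := by
    have h1 : HasDerivAt (fun t : ℝ => -s * (t : ℂ)) (-s) t := by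
      simpa using (Complex.ofRealCLM.hasDerivAt (x := t)).const_mul (-s)
    exact h1.cexp
  have hint {S : Set ℝ} {u : ℝ → ℝ} (hu : IntegrableOn u S) :
      IntegrableOn (fun t : ℝ => Complex.exp (-s * t) * (u t : ℂ)) S := by
    refine Integrable.bdd_mul (c := 1) hu.ofReal hexpc.aestronglyMeasurable ?_
    exact Eventually.of_forall fun t => (hnorm t).le
  have hXj (j : ν) : ContinuousOn (fun t => X t j) (Icc 0 T) :=
    ((continuousOn_pi.1 hX) j).mono Icc_subset_Ici_self
  have hXi (j : ν) : IntegrableOn (fun t => X t j) (Ioc 0 T) :=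
    ((hXj j).integrableOn_Icc).mono_set Ioc_subset_Icc_self
  funext j
  have sum_eq {S : Set ℝ} (u : ℝ → ν → ℝ) (hu : ∀ j, IntegrableOn (fun t => u t j) S) :
      ∫ t in S, Complex.exp (-s * t) * ((A *ᵥ u t) j : ℂ) =
        ∑ k, (A j k : ℂ) * ∫ t in S, Complex.exp (-s * t) * (u t k : ℂ) := by
    simp_rw [← integral_const_mul]
    rw [← integral_finsetSum _ fun k _ => (hint (hu k)).const_mul _]
    congr 1
    ext t
    simp only [mulVec, dotProduct, Complex.ofReal_sum, Complex.ofReal_mul, Finset.mul_sum]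
    exact Finset.sum_congr rfl fun k _ => by ring
  have mulVec_int {S : Set ℝ} (u : ℝ → ν → ℝ) (hu : ∀ j, IntegrableOn (fun t => u t j) S) :
      IntegrableOn (fun t => (A *ᵥ u t) j) S := integrableOn_mulVec_apply A hu j
  have h1 : ∫ t in Ioc 0 T, (Complex.exp (-s * t) * (-s) * (X t j : ℂ) +
      Complex.exp (-s * t) * ((A *ᵥ X t + y t • b) j : ℝ)) = Complex.exp (-s * T) * X T j := by
    rw [← intervalIntegral.integral_of_le hT,
      intervalIntegral.integral_eq_sub_of_hasDeriv_right_of_le hT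
        (f := fun t : ℝ => Complex.exp (-s * t) * (X t j : ℂ))]
    · simp [hX0]
    · exact hexpc.continuousOn.mul (Complex.continuous_ofReal.comp_continuousOn (hXj j))
    · intro t ht
      have h2 := (hasDerivWithinAt_pi.1 (hX' t ht.1.le)) j
      exact ((hd t).hasDerivWithinAt.mul h2.ofReal_comp).mono Ioi_subset_Ici_self
    · rw [intervalIntegrable_iff_integrableOn_Ioc_of_le hT]
      refine Integrable.add ?_ (hint ?_)
      · simp_rw [mul_right_comm _ (-s)]
        exact (hint (hXi j)).mul_const _
      · exact (mulVec_int X hXi).add (hy.mul_const (b j))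
  have h2 : ∫ t in Ioi T, (Complex.exp (-s * t) * (-s) * (Y t j : ℂ) +
      Complex.exp (-s * t) * ((A *ᵥ Y t) j : ℝ)) = 0 - Complex.exp (-s * T) * X T j := by
    rw [integral_Ioi_of_hasDerivAt_of_tendsto (m := 0)
        (f := fun t : ℝ => Complex.exp (-s * t) * (Y t j : ℂ)), hYT]
    · exact ((hd T).mul ((hasDerivAt_pi.1 (hY' T)) j).ofReal_comp).continuousAt.continuousWithinAt
    · intro t _
      exact (hd t).mul ((hasDerivAt_pi.1 (hY' t)) j).ofReal_comp
    · refine Integrable.add ?_ (hint (mulVec_int Y hYi))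
      simp_rw [mul_right_comm _ (-s)]
      exact (hint (hYi j)).mul_const _
    · rw [tendsto_zero_iff_norm_tendsto_zero]
      simp only [norm_mul, hnorm, one_mul]
      have := ((tendsto_pi_nhds.1 hYlim) j).norm
      simpa using this
  have h3 : ∫ t in Ioc 0 T, (Complex.exp (-s * t) * (-s) * (X t j : ℂ) +
      Complex.exp (-s * t) * ((A *ᵥ X t + y t • b) j : ℝ)) =
      -s * (∫ t in Ioc 0 T, Complex.exp (-s * t) * (X t j : ℂ)) +
      ((∑ k, (A j k : ℂ) * ∫ t in Ioc 0 T, Complex.exp (-s * t) * (X t k : ℂ)) +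
        (∫ t in Ioc 0 T, Complex.exp (-s * t) * (y t : ℂ)) * b j) := by
    rw [← sum_eq X hXi, ← integral_mul_const, ← integral_const_mul, ← add_assoc,
      ← integral_add_add ((hint (hXi j)).const_mul _) (hint (mulVec_int X hXi))
        ((hint hy).mul_const _)]
    congr 1
    ext t
    simp
    ring
  have h4 : ∫ t in Ioi T, (Complex.exp (-s * t) * (-s) * (Y t j : ℂ) +
      Complex.exp (-s * t) * ((A *ᵥ Y t) j : ℝ)) =
      -s * (∫ t in Ioi T, Complex.exp (-s * t) * (Y t j : ℂ)) +
      ∑ k, (A j k : ℂ) * ∫ t in Ioi T, Complex.exp (-s * t) * (Y t k : ℂ) := by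
    rw [← sum_eq Y hYi, ← integral_const_mul, ← integral_add ((hint (hYi j)).const_mul _)
      (hint (mulVec_int Y hYi))]
    congr 1
    ext t
    ring
  have h5 : (A.map (algebraMap ℝ ℂ) *ᵥ v) j =
      (∑ k, (A j k : ℂ) * ∫ t in Ioc 0 T, Complex.exp (-s * t) * (X t k : ℂ)) +
        ∑ k, (A j k : ℂ) * ∫ t in Ioi T, Complex.exp (-s * t) * (Y t k : ℂ) := by
    simp [mulVec, dotProduct, hv, mul_add, Finset.sum_add_distrib]
  rw [Pi.add_apply, h5, Pi.smul_apply, Pi.smul_apply, hv, smul_eq_mul, smul_eq_mul,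
    Complex.coe_algebraMap]
  linear_combination h3 + h4 - h1 - h2

theorem memLp_two_of_integrable_of_bounded {f : ℝ → ℝ} (hf : Integrable f) {C : ℝ}
    (hC : ∀ t, ‖f t‖ ≤ C) : MemLp f 2 := by
  rw [memLp_two_iff_integrable_sq hf.aestronglyMeasurable]
  simp only [sq]
  exact hf.bdd_mul hf.aestronglyMeasurable (Eventually.of_forall hC)

theorem fourier_ofReal_eq (f : ℝ → ℝ) (ξ : ℝ) : 𝓕 (fun t => (f t : ℂ)) ξ =
    ∫ t : ℝ, Complex.exp (-(Complex.I * ((2 * Real.pi * ξ : ℝ) : ℂ)) * t) * (f t : ℂ) := by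
  rw [Real.fourier_real_eq_integral_exp_smul]
  congr 1
  ext t
  rw [smul_eq_mul]
  congr 2
  push_cast
  ring

variable [DecidableEq ν]

/-- Let `δ` be stable with `[1; δ]* P₀ [1; δ] ≥ 0` on the imaginary axis, where the corner `r` of
`P₀ = [q s; s r]` is nonpositive. Then the filter `w = δ y` satisfies the quadratic constraint of
`P₀` on every finite horizon: if `y` is cut off at time `T`, Plancherel's identity gives
the constraint over `[0, ∞)`, and beyond `T` the integrand is `r w² ≤ 0`. -/
theorem integral_quadratic_filtered_nonneg (q s r : ℝ) (hr : r ≤ 0) (δ : RatFunc ℝ)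
    (hδ : IsStableTransferFunction δ) (sys : StateSpace ν (Fin 1) (Fin 1)) (hmin : sys.IsMinimal)
    (htf : sys.transferMatrix = !![δ])
    (hFDI : ∀ ω : ℝ, 0 ≤
      q + 2 * s * (aeval (Complex.I * ω) δ.num / aeval (Complex.I * ω) δ.denom).re +
      r * Complex.normSq (aeval (Complex.I * ω) δ.num / aeval (Complex.I * ω) δ.denom))
    (X : ℝ → ν → ℝ) (y : ℝ → ℝ) (hX0 : X 0 = 0) (hX : ContinuousOn X (Ici 0))
    (hX' : ∀ t, 0 ≤ t →
      HasDerivWithinAt X (sys.A *ᵥ X t + y t • fun j => sys.B j 0) (Ici t) t)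
    {T : ℝ} (hT : 0 ≤ T) (hy : IntegrableOn y (Ioc 0 T)) {Cy : ℝ}
    (hyb : ∀ t ∈ Ioc 0 T, ‖y t‖ ≤ Cy) :
    0 ≤ ∫ t in (0 : ℝ)..T, (q * y t ^ 2 + 2 * s * (y t * (sys.C 0 ⬝ᵥ X t + sys.D 0 0 * y t)) +
      r * (sys.C 0 ⬝ᵥ X t + sys.D 0 0 * y t) ^ 2) := by
  obtain ⟨Y, hYT, hY'⟩ := exists_hasDerivAt_linear sys.A (fun _ => 0) continuous_const T (X T)
  simp only [add_zero] at hY'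
  have hYc : Continuous Y := continuous_iff_continuousAt.2 fun t => (hY' t).continuousAt
  obtain ⟨C, ε, hC, hε, hdecay⟩ := exists_norm_le_exp_of_aeval_eq_zero sys.A δ.denom
    δ.monic_denom hδ.2 (aeval_denom_eq_zero_of_isMinimal sys δ hmin htf) (fun t => Y (t + T))
    (hYc.comp (continuous_id.add continuous_const)).continuousOn
    (fun t _ => ((hY' (t + T)).comp_add_const t T).hasDerivWithinAt)
  have hYb (t : ℝ) (ht : T < t) : ‖Y t‖ ≤ C * Real.exp (-ε * (t - T)) := by
    simpa using hdecay (t - T) (by linarith)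
  have hYb' (t : ℝ) (ht : T < t) : ‖Y t‖ ≤ C := by
    refine (hYb t ht).trans (mul_le_of_le_one_right hC ?_)
    rw [Real.exp_le_one_iff]
    nlinarith
  have hYi (j : ν) : IntegrableOn (fun t => Y t j) (Ioi T) := by
    have h1 : IntegrableOn (fun t => C * Real.exp (ε * T) * Real.exp (-ε * t)) (Ioi T) :=
      (exp_neg_integrableOn_Ioi T hε).const_mul _
    refine h1.mono' ((continuous_apply j).comp hYc).aestronglyMeasurable ?_
    filter_upwards [ae_restrict_mem measurableSet_Ioi] with t ht
    refine (norm_le_pi_norm _ j).trans ((hYb t ht).trans_eq ?_)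
    rw [mul_assoc, ← Real.exp_add]
    ring_nf
  have hYlim : Tendsto Y atTop (𝓝 0) := by
    have h1 : Tendsto (fun t => C * Real.exp (-ε * (t - T))) atTop (𝓝 (C * 0)) := by
      refine (Real.tendsto_exp_atBot.comp ?_).const_mul C
      exact (tendsto_atTop_add_const_right _ (-T) tendsto_id).const_mul_atTop_of_neg (by linarith)
    rw [mul_zero] at h1
    exact squeeze_zero_norm' ((eventually_gt_atTop T).mono hYb) h1
  obtain ⟨Cx, hCx⟩ := isCompact_Icc.exists_bound_of_continuousOn
    (hX.mono (Icc_subset_Ici_self : Icc 0 T ⊆ Ici 0))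
  -- the input `f`, the state `h` and the output `g` of the filter with truncated input
  set f : ℝ → ℝ := (Ioc 0 T).indicator y with hf
  set h : ν → ℝ → ℝ := fun j t => (Ioc 0 T).indicator (fun t => X t j) t +
    (Ioi T).indicator (fun t => Y t j) t with hh
  set g : ℝ → ℝ := fun t => (∑ j, sys.C 0 j * h j t) + sys.D 0 0 * f t with hg
  have hXi (j : ν) : IntegrableOn (fun t => X t j) (Ioc 0 T) :=
    ((((continuousOn_pi.1 hX) j).mono Icc_subset_Ici_self).integrableOn_Icc).mono_set
      Ioc_subset_Icc_self
  have hf1 : Integrable f := hy.integrable_indicator measurableSet_Ioc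
  have hX1 (j : ν) : Integrable ((Ioc 0 T).indicator fun t => X t j) :=
    (hXi j).integrable_indicator measurableSet_Ioc
  have hY1 (j : ν) : Integrable ((Ioi T).indicator fun t => Y t j) :=
    (hYi j).integrable_indicator measurableSet_Ioi
  have hf2 : MemLp f 2 := by
    refine memLp_two_of_integrable_of_bounded hf1 (C := max Cy 0) fun t => ?_
    by_cases ht : t ∈ Ioc 0 T
    · simpa [hf, ht] using Or.inl (hyb t ht)
    · simp [hf, ht]
  have hX2 (j : ν) : MemLp ((Ioc 0 T).indicator fun t => X t j) 2 := by
    refine memLp_two_of_integrable_of_bounded (hX1 j) (C := max Cx 0) fun t => ?_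
    by_cases ht : t ∈ Ioc 0 T
    · rw [indicator_of_mem ht]
      exact le_max_of_le_left ((norm_le_pi_norm _ j).trans (hCx t (Ioc_subset_Icc_self ht)))
    · simp [ht]
  have hY2 (j : ν) : MemLp ((Ioi T).indicator fun t => Y t j) 2 := by
    refine memLp_two_of_integrable_of_bounded (hY1 j) (C := C) fun t => ?_
    by_cases ht : t ∈ Ioi T
    · rw [indicator_of_mem ht]
      exact (norm_le_pi_norm _ j).trans (hYb' t ht)
    · simpa [ht] using hC
  have hh1 (j : ν) : Integrable (h j) := (hX1 j).add (hY1 j)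
  have hg1 : Integrable g :=
    (integrable_finsetSum _ fun j _ => (hh1 j).const_mul _).add (hf1.const_mul _)
  have hg2 : MemLp g 2 :=
    (memLp_finsetSum _ fun j _ => ((hX2 j).add (hY2 j)).const_mul _).add (hf2.const_mul _)
  have key := integral_quadratic_nonneg_of_fourier q s r f g hf1 hf2 hg1 hg2
    (fun ξ => aeval (Complex.I * ((2 * Real.pi * ξ : ℝ) : ℂ)) δ.num /
      aeval (Complex.I * ((2 * Real.pi * ξ : ℝ) : ℂ)) δ.denom)
    (fun ξ => by
      set σ : ℂ := Complex.I * ((2 * Real.pi * ξ : ℝ) : ℂ) with hσ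
      have hσ0 : σ.re = 0 := by simp [hσ]
      have hexp {u : ℝ → ℝ} (hu : Integrable u) :
          Integrable fun t : ℝ => Complex.exp (-σ * t) * (u t : ℂ) := by
        refine Integrable.bdd_mul (c := 1) hu.ofReal (by fun_prop) ?_
        exact Eventually.of_forall fun t => by simp [Complex.norm_exp, hσ0]
      have hind {S : Set ℝ} (hS : MeasurableSet S) (u : ℝ → ℝ) :
          ∫ t : ℝ, Complex.exp (-σ * t) * ((S.indicator u t : ℝ) : ℂ) =
            ∫ t in S, Complex.exp (-σ * t) * (u t : ℂ) := by
        rw [← integral_indicator hS]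
        congr 1
        ext t
        by_cases ht : t ∈ S <;> simp [ht]
      have hv := laplace_truncated_response sys.A (fun j => sys.B j 0) hT X Y y hX0 hX hX' hy hYT
        hY' hYi hYlim σ hσ0 _ fun j => rfl
      have hout := denom_mul_output_eq sys δ hmin htf σ _ _ hv
      have hne : aeval σ δ.denom ≠ 0 := fun h0 => by
        have := hδ.2 σ h0
        linarith
      rw [fourier_ofReal_eq, fourier_ofReal_eq, ← hσ, div_mul_eq_mul_div, eq_div_iff hne, hf,
        hind measurableSet_Ioc, ← hout, mul_comm]
      congr 1
      have hsplit (t : ℝ) : Complex.exp (-σ * t) * (g t : ℂ) =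
          (∑ j, (sys.C 0 j : ℂ) * (Complex.exp (-σ * t) * (h j t : ℂ))) +
            sys.D 0 0 * (Complex.exp (-σ * t) * (f t : ℂ)) := by
        simp only [hg, Complex.ofReal_add, Complex.ofReal_sum, Complex.ofReal_mul, mul_add,
          Finset.mul_sum]
        congr 1
        · exact Finset.sum_congr rfl fun j _ => by ring
        · ring
      simp_rw [hsplit]
      rw [integral_add (integrable_finsetSum _ fun j _ => (hexp (hh1 j)).const_mul _)
        ((hexp hf1).const_mul _), integral_const_mul,
        integral_finsetSum _ fun j _ => (hexp (hh1 j)).const_mul _, hf, hind measurableSet_Ioc]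
      congr 1
      refine Finset.sum_congr rfl fun j _ => ?_
      rw [integral_const_mul]
      congr 1
      simp only [hh, Complex.ofReal_add, mul_add]
      rw [integral_add (hexp (hX1 j)) (hexp (hY1 j)), hind measurableSet_Ioc,
        hind measurableSet_Ioi])
    (fun ξ => hFDI _)
  rw [intervalIntegral.integral_of_le hT, ← integral_indicator measurableSet_Ioc]
  have hin (t : ℝ) (ht : t ∈ Ioc 0 T) : f t = y t ∧ g t = sys.C 0 ⬝ᵥ X t + sys.D 0 0 * y t := by
    have h1 : t ∉ Ioi T := not_lt.2 ht.2
    simp [hf, hg, hh, ht.1, ht.2, h1, dotProduct]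
  have hint : Integrable fun t => q * f t ^ 2 + 2 * s * (f t * g t) + r * g t ^ 2 :=
    ((hf2.integrable_sq.const_mul q).add ((hf2.integrable_mul hg2).const_mul _)).add
      (hg2.integrable_sq.const_mul r)
  have hcongr : (Ioc 0 T).indicator (fun t => q * y t ^ 2 +
      2 * s * (y t * (sys.C 0 ⬝ᵥ X t + sys.D 0 0 * y t)) +
      r * (sys.C 0 ⬝ᵥ X t + sys.D 0 0 * y t) ^ 2) =
      (Ioc 0 T).indicator fun t => q * f t ^ 2 + 2 * s * (f t * g t) + r * g t ^ 2 :=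
    indicator_congr fun t ht => by rw [(hin t ht).1, (hin t ht).2]
  rw [hcongr]
  refine key.trans (integral_mono hint (hint.indicator measurableSet_Ioc) fun t => ?_)
  by_cases ht : t ∈ Ioc 0 T
  · simp [ht]
  · have h0 : f t = 0 := by simp [hf, ht]
    simp only [h0, indicator_of_notMem ht]
    nlinarith [sq_nonneg (g t)]

end Dissipation

/-! ### Signals are bounded and measurable -/

section Signals

open MeasureTheory

variable {μ : Type*}

theorem IsSignal.exists_bound {u : ℝ → μ → ℝ} (hu : IsSignal u) (T : ℝ) (i : μ) :
    ∃ C, ∀ t ∈ Ioc 0 T, ‖u t i‖ ≤ C := by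
  -- One-sided limits make `u` locally bounded; then use compactness of `[0, T]`.
  have hloc : ∀ t ∈ Icc 0 T, ∃ V ∈ 𝓝[Icc 0 T] t, ∃ C, ∀ τ ∈ V, ‖u τ i‖ ≤ C := by
    intro t ht
    have bdd {l : Filter ℝ} {a : ℝ} (h : Tendsto (fun t => u t i) l (𝓝 a)) :
        ∀ᶠ τ in l, ‖u τ i‖ ≤ ‖a‖ + 1 :=
      (h.norm.eventually (gt_mem_nhds (lt_add_one _))).mono fun _ h => h.le
    have hr := bdd ((tendsto_pi_nhds.1 (hu.1 t ht.1)) i)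
    rcases ht.1.eq_or_lt with h0 | h0
    · exact ⟨{τ | ‖u τ i‖ ≤ ‖u t i‖ + 1}, nhdsWithin_mono _ (h0 ▸ Icc_subset_Ici_self) hr, _,
        fun τ hτ => hτ⟩
    · obtain ⟨a, ha⟩ := hu.2.1 t h0
      have hl := bdd ((tendsto_pi_nhds.1 ha) i)
      refine ⟨{τ | ‖u τ i‖ ≤ max (‖u t i‖ + 1) (‖a i‖ + 1)}, ?_, _, fun τ hτ => hτ⟩
      refine nhdsWithin_le_nhds ?_
      rw [← nhdsLT_sup_nhdsGE]
      exact ⟨hl.mono fun _ h => h.trans (le_max_right _ _),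
        hr.mono fun _ h => h.trans (le_max_left _ _)⟩
  obtain ⟨C, hC⟩ := isCompact_Icc.induction_on (p := fun S => ∃ C, ∀ τ ∈ S, ‖u τ i‖ ≤ C)
    ⟨0, by simp⟩ (fun S S' hS ⟨C, hC⟩ => ⟨C, fun τ hτ => hC τ (hS hτ)⟩)
    (fun S S' ⟨C, hC⟩ ⟨C', hC'⟩ => ⟨max C C', fun τ hτ => hτ.elim
      (fun h => (hC τ h).trans (le_max_left _ _)) (fun h => (hC' τ h).trans (le_max_right _ _))⟩)
    hloc
  exact ⟨C, fun t ht => hC t (Ioc_subset_Icc_self ht)⟩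

theorem IsSignal.integrableOn {u : ℝ → μ → ℝ} (hu : IsSignal u) (T : ℝ) (i : μ) :
    IntegrableOn (fun t => u t i) (Ioc 0 T) := by
  obtain ⟨C, hC⟩ := hu.exists_bound T i
  set N := {t ∈ Icc 0 T | ¬ ContinuousWithinAt u (Ici 0) t} with hN
  have hNf : N.Finite := hu.2.2 T
  have hcont : ContinuousOn (fun t => u t i) (Ioc 0 T \ N) := by
    intro t ht
    have h1 : ContinuousWithinAt u (Ici 0) t := by
      by_contra h
      exact ht.2 ⟨Ioc_subset_Icc_self ht.1, h⟩
    exact ((continuousWithinAt_pi.1 h1) i).mono fun τ hτ => hτ.1.1.le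
  have hae : (Ioc 0 T \ N : Set ℝ) =ᵐ[volume] Ioc 0 T := sdiff_null_ae_eq_self (hNf.measure_zero _)
  have hmeas : AEStronglyMeasurable (fun t => u t i) (volume.restrict (Ioc 0 T)) := by
    rw [← Measure.restrict_congr_set hae]
    exact hcont.aestronglyMeasurable (measurableSet_Ioc.diff hNf.measurableSet)
  refine Integrable.mono' (integrable_const C) hmeas ?_
  filter_upwards [ae_restrict_mem measurableSet_Ioc] with t ht using hC t ht

end Signals

/-! ### Linear filters commute -/

section Commute

variable {ν ν' : Type*} [Fintype ν] [Fintype ν']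

theorem eq_zero_of_hasDerivWithinAt_linear (A : Matrix ν ν ℝ) (u : ℝ → ν → ℝ) (h0 : u 0 = 0)
    (hu : ContinuousOn u (Ici 0))
    (hu' : ∀ t, 0 ≤ t → HasDerivWithinAt u (A *ᵥ u t) (Ici t) t) :
    ∀ t, 0 ≤ t → u t = 0 := by
  classical
  intro t ht
  set L : (ν → ℝ) →L[ℝ] (ν → ℝ) := (toLin' A).toContinuousLinearMap with hL
  have hLA (v : ν → ℝ) : L v = A *ᵥ v := by simp [hL]
  have := norm_le_gronwallBound_of_norm_deriv_right_le (f := u) (f' := fun t => A *ᵥ u t)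
    (δ := 0) (K := ‖L‖) (ε := 0) (a := 0) (b := t)
    (hu.mono Icc_subset_Ici_self) (fun s hs => hu' s hs.1) (by simp [h0])
    (fun s _ => by rw [← hLA, add_zero]; exact L.le_opNorm _) t ⟨ht, le_rfl⟩
  simpa [gronwallBound_ε0_δ0] using this

theorem eqOn_of_hasDerivWithinAt_linear (A : Matrix ν ν ℝ) (f u v : ℝ → ν → ℝ) (h0 : u 0 = v 0)
    (hu : ContinuousOn u (Ici 0)) (hv : ContinuousOn v (Ici 0))
    (hu' : ∀ t, 0 ≤ t → HasDerivWithinAt u (A *ᵥ u t + f t) (Ici t) t)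
    (hv' : ∀ t, 0 ≤ t → HasDerivWithinAt v (A *ᵥ v t + f t) (Ici t) t)
    (t : ℝ) (ht : 0 ≤ t) : u t = v t := by
  refine sub_eq_zero.1 (eq_zero_of_hasDerivWithinAt_linear A (fun t => u t - v t) (by simp [h0])
    (hu.sub hv) (fun t ht => ?_) t ht)
  convert! (hu' t ht).sub (hv' t ht) using 1
  rw [mulVec_sub]
  abel

/-- Filters in series commute. Let `w` be the output of the filter `sys` driven by `z`, and let
`ξ₁`, `ξ₂` be the responses of `ξ' = A ξ + b u` to `z` and `w`. Then `c ξ₂ + e w` is the output of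
`sys` driven by `c ξ₁ + e z`. -/
theorem exists_response_of_filtered (sys : StateSpace ν' (Fin 1) (Fin 1)) (A : Matrix ν ν ℝ)
    (b c : ν → ℝ) (e : ℝ) (z w : ℝ → ℝ) (x : ℝ → ν' → ℝ) (ξ₁ ξ₂ : ℝ → ν → ℝ)
    (hx0 : x 0 = 0) (hx : ContinuousOn x (Ici 0))
    (hx' : ∀ t, 0 ≤ t → HasDerivWithinAt x (sys.A *ᵥ x t + z t • fun j => sys.B j 0) (Ici t) t)
    (hw : ∀ t, 0 ≤ t → w t = sys.C 0 ⬝ᵥ x t + sys.D 0 0 * z t)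
    (h10 : ξ₁ 0 = 0) (h1 : ContinuousOn ξ₁ (Ici 0))
    (h1' : ∀ t, 0 ≤ t → HasDerivWithinAt ξ₁ (A *ᵥ ξ₁ t + z t • b) (Ici t) t)
    (h20 : ξ₂ 0 = 0) (h2 : ContinuousOn ξ₂ (Ici 0))
    (h2' : ∀ t, 0 ≤ t → HasDerivWithinAt ξ₂ (A *ᵥ ξ₂ t + w t • b) (Ici t) t) :
    ∃ X : ℝ → ν' → ℝ, X 0 = 0 ∧ ContinuousOn X (Ici 0) ∧
      (∀ t, 0 ≤ t → HasDerivWithinAt X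
        (sys.A *ᵥ X t + (c ⬝ᵥ ξ₁ t + e * z t) • fun j => sys.B j 0) (Ici t) t) ∧
      ∀ t, 0 ≤ t →
        c ⬝ᵥ ξ₂ t + e * w t = sys.C 0 ⬝ᵥ X t + sys.D 0 0 * (c ⬝ᵥ ξ₁ t + e * z t) := by
  classical
  -- `Ξ j` is the response of `ξ' = A ξ + b u` to the `j`-th component of the state `x`; the
  -- state of `sys` driven by `c ξ₁ + e z` is then `c Ξ j + e x j`.
  have hex (j : ν') : ∃ Ξ : ℝ → ν → ℝ, Ξ 0 = 0 ∧ ContinuousOn Ξ (Ici 0) ∧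
      ∀ t, 0 ≤ t → HasDerivWithinAt Ξ (A *ᵥ Ξ t + x t j • b) (Ici t) t := by
    have hc : Continuous fun t => x (max t 0) j • b := by
      have : Continuous fun t => x (max t 0) :=
        hx.comp_continuous (by fun_prop) fun t => mem_Ici.2 (le_max_right _ _)
      exact ((continuous_apply j).comp this).smul continuous_const
    obtain ⟨Ξ, h0, h⟩ := exists_hasDerivAt_linear A _ hc 0 0
    refine ⟨Ξ, h0, fun t _ => (h t).continuousAt.continuousWithinAt, fun t ht => ?_⟩
    have := (h t).hasDerivWithinAt (s := Ici t)
    rwa [max_eq_left ht] at this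
  choose Ξ hΞ0 hΞ hΞ' using hex
  have sumD {F : ν' → ℝ → ν → ℝ} {F' : ν' → ν → ℝ} {t : ℝ} (a : ν' → ℝ)
      (h : ∀ k, HasDerivWithinAt (F k) (F' k) (Ici t) t) :
      HasDerivWithinAt (fun t => ∑ k, a k • F k t) (∑ k, a k • F' k) (Ici t) t :=
    HasDerivWithinAt.fun_sum fun k _ => (h k).const_smul (a k)
  have sumC (a : ν' → ℝ) : ContinuousOn (fun t => ∑ k, a k • Ξ k t) (Ici 0) :=
    continuousOn_finsetSum _ fun k _ => (hΞ k).const_smul (a k)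
  have sumA (a : ν' → ℝ) (t : ℝ) :
      A *ᵥ ∑ k, a k • Ξ k t = ∑ k, a k • A *ᵥ Ξ k t := by
    rw [mulVec_sum]; simp only [mulVec_smul]
  have sumb (a : ν' → ℝ) (t : ℝ) : ∑ k, a k • x t k • b = (a ⬝ᵥ x t) • b := by
    simp only [dotProduct, Finset.sum_smul, smul_smul]
  -- `Ξ` also solves the equation in which the filters are interchanged: the defect has zero
  -- initial value and satisfies `u' = A u`.
  have comm (t : ℝ) (ht : 0 ≤ t) (j : ν') :
      A *ᵥ Ξ j t + x t j • b = (∑ k, sys.A j k • Ξ k t) + sys.B j 0 • ξ₁ t := by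
    have hxj (t : ℝ) (ht : 0 ≤ t) := (hasDerivWithinAt_pi.1 (hx' t ht)) j
    refine sub_eq_zero.1 (eq_zero_of_hasDerivWithinAt_linear A
      (fun t => A *ᵥ Ξ j t + x t j • b - ((∑ k, sys.A j k • Ξ k t) + sys.B j 0 • ξ₁ t))
      (by simp [hΞ0, h10, hx0]) ?_ (fun t ht => ?_) t ht)
    · exact (((hΞ j).matrix_mulVec_const A).add (((continuousOn_pi.1 hx) j).smul
        continuousOn_const)).sub ((sumC _).add (h1.const_smul (sys.B j 0)))
    · convert! (((hΞ' j t ht).matrix_mulVec A).add ((hxj t ht).smul_const b)).sub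
        ((sumD (sys.A j) fun k => hΞ' k t ht).add ((h1' t ht).const_smul (sys.B j 0))) using 1
      simp only [smul_add, Finset.sum_add_distrib, sumb, mulVec_sub, mulVec_add, mulVec_smul, sumA]
      simp only [Pi.add_apply, Pi.smul_apply, smul_eq_mul, add_smul]
      rw [show (sys.A *ᵥ x t) j = sys.A j ⬝ᵥ x t from rfl, mul_comm (z t), mul_smul]
      abel
  have hξ₂ (t : ℝ) (ht : 0 ≤ t) :
      ξ₂ t = (∑ k, sys.C 0 k • Ξ k t) + sys.D 0 0 • ξ₁ t := by
    refine eqOn_of_hasDerivWithinAt_linear A (fun t => w t • b) ξ₂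
      (fun t => (∑ k, sys.C 0 k • Ξ k t) + sys.D 0 0 • ξ₁ t) (by simp [h20, hΞ0, h10]) h2
 
      ((sumC _).add (h1.const_smul (sys.D 0 0))) h2' (fun t ht => ?_) t ht
    convert! (sumD (sys.C 0) fun k => hΞ' k t ht).add ((h1' t ht).const_smul (sys.D 0 0)) using 1
    simp only [smul_add, Finset.sum_add_distrib, sumb, mulVec_add, mulVec_smul, sumA, hw t ht,
      add_smul, mul_smul]
    abel
  have dotX (a : ν' → ℝ) (t : ℝ) : a ⬝ᵥ (fun j => c ⬝ᵥ Ξ j t + e * x t j) =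
      ∑ k, a k * c ⬝ᵥ Ξ k t + e * a ⬝ᵥ x t := by
    simp only [dotProduct, mul_add, Finset.sum_add_distrib, Finset.mul_sum]
    congr 1
    exact Finset.sum_congr rfl fun i _ => by ring
  refine ⟨fun t j => c ⬝ᵥ Ξ j t + e * x t j, ?_, ?_, fun t ht => ?_, fun t ht => ?_⟩
  · ext j; simp [hΞ0, hx0]
  · refine continuousOn_pi.2 fun j => ContinuousOn.add ?_
      (continuousOn_const.mul ((continuousOn_pi.1 hx) j))
    simp only [dotProduct]
    exact continuousOn_finsetSum _ fun k _ => continuousOn_const.mul ((continuousOn_pi.1 (hΞ j)) k)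
  · refine hasDerivWithinAt_pi.2 fun j => ?_
    have hdot : HasDerivWithinAt (fun t => c ⬝ᵥ Ξ j t) (c ⬝ᵥ (A *ᵥ Ξ j t + x t j • b))
        (Ici t) t := by
      simp only [dotProduct]
      exact HasDerivWithinAt.fun_sum fun k _ =>
        ((hasDerivWithinAt_pi.1 (hΞ' j t ht)) k).const_mul _
    convert! hdot.add (((hasDerivWithinAt_pi.1 (hx' t ht)) j).const_mul e) using 1
    rw [comm t ht j, dotProduct_add, dotProduct_sum]
    simp only [Pi.add_apply, Pi.smul_apply, smul_eq_mul, dotProduct_smul]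
    rw [show (sys.A *ᵥ x t) j = sys.A j ⬝ᵥ x t from rfl, show (sys.A *ᵥ _) j = sys.A j ⬝ᵥ _ from rfl,
      dotX]
    ring
  · rw [hξ₂ t ht, hw t ht, dotProduct_add, dotProduct_sum, dotX]
    simp only [dotProduct_smul, smul_eq_mul]
    ring

end Commute

/-! ### Block-diagonal filters and the dissipation inequality of the certificate -/

section Certificate

open MeasureTheory

theorem StateSpace.transferMatrix_diag {ν₁ μ₁ κ₁ ν₂ μ₂ κ₂ : Type*} [Fintype ν₁] [DecidableEq ν₁]
    [Fintype ν₂] [DecidableEq ν₂] (sys₁ : StateSpace ν₁ μ₁ κ₁) (sys₂ : StateSpace ν₂ μ₂ κ₂) :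
    (sys₁.diag sys₂).transferMatrix =
      fromBlocks sys₁.transferMatrix 0 0 sys₂.transferMatrix := by
  have h1 := isUnit_X_smul_one_sub sys₁.A
  have h2 := isUnit_X_smul_one_sub sys₂.A
  have hinv : ((RatFunc.X : RatFunc ℝ) • (1 : Matrix (ν₁ ⊕ ν₂) (ν₁ ⊕ ν₂) (RatFunc ℝ)) -
      (sys₁.diag sys₂).A.map RatFunc.C)⁻¹ =
      fromBlocks ((RatFunc.X : RatFunc ℝ) • (1 : Matrix ν₁ ν₁ (RatFunc ℝ)) -
        sys₁.A.map RatFunc.C)⁻¹ 0 0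
        ((RatFunc.X : RatFunc ℝ) • (1 : Matrix ν₂ ν₂ (RatFunc ℝ)) - sys₂.A.map RatFunc.C)⁻¹ := by
    apply Matrix.inv_eq_right_inv
    have : (RatFunc.X : RatFunc ℝ) • (1 : Matrix (ν₁ ⊕ ν₂) (ν₁ ⊕ ν₂) (RatFunc ℝ)) -
        (sys₁.diag sys₂).A.map RatFunc.C =
        fromBlocks ((RatFunc.X : RatFunc ℝ) • (1 : Matrix ν₁ ν₁ (RatFunc ℝ)) -
          sys₁.A.map RatFunc.C) 0 0
          ((RatFunc.X : RatFunc ℝ) • (1 : Matrix ν₂ ν₂ (RatFunc ℝ)) - sys₂.A.map RatFunc.C) := by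
      ext (i | i) (j | j) <;> simp [StateSpace.diag, Matrix.one_apply]
    rw [this, fromBlocks_multiply]
    simp [Matrix.mul_nonsing_inv _ h1, Matrix.mul_nonsing_inv _ h2]
  rw [StateSpace.transferMatrix, hinv]
  simp only [StateSpace.diag, fromBlocks_map, fromBlocks_multiply, fromBlocks_add]
  simp [StateSpace.transferMatrix, Matrix.map_zero]

theorem kroneckerTwo_isSymm {κ : Type*} {P₀ : Matrix (Fin 2) (Fin 2) ℝ} {N : Matrix κ κ ℝ}
    (hP₀ : P₀.IsSymm) (hN : N.IsSymm) : (kroneckerTwo P₀ N).IsSymm := by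
  refine IsSymm.fromBlocks (hN.smul _) ?_ (hN.smul _)
  rw [transpose_smul, hN.eq, hP₀.apply]

theorem sumElim_dotProduct_kroneckerTwo {κ : Type*} [Fintype κ] (P₀ : Matrix (Fin 2) (Fin 2) ℝ)
    (N : Matrix κ κ ℝ) (a₁ a₂ b₁ b₂ : κ → ℝ) :
    Sum.elim a₁ a₂ ⬝ᵥ (kroneckerTwo P₀ N *ᵥ Sum.elim b₁ b₂) =
      P₀ 0 0 * (a₁ ⬝ᵥ N *ᵥ b₁) + P₀ 0 1 * (a₁ ⬝ᵥ N *ᵥ b₂) +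
        P₀ 1 0 * (a₂ ⬝ᵥ N *ᵥ b₁) + P₀ 1 1 * (a₂ ⬝ᵥ N *ᵥ b₂) := by
  simp only [kroneckerTwo, fromBlocks_mulVec, sumElim_dotProduct_sumElim, Sum.elim_comp_inl,
    Sum.elim_comp_inr, dotProduct_add, smul_mulVec, dotProduct_smul, smul_eq_mul]
  ring

/-- The positive definite difference of the two sides of the certificate inequality is a sum of
squares of linear forms in state and input; polarized, this expresses the difference between the
supply rate of `M` and the derivative of the storage function of `K`. -/
theorem StateSpace.IsCertificate.exists_sum_of_squares {ν κ : Type*} [Fintype ν] [DecidableEq ν]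
    [Fintype κ] {sys : StateSpace ν (Fin 1) κ} {M : Matrix κ κ ℝ} {K : Matrix ν ν ℝ}
    (hK : sys.IsCertificate M K) :
    ∃ (m : ℕ) (c : Fin m → ν → ℝ) (e : Fin m → ℝ), ∀ (x x' : ν → ℝ) (u u' : Fin 1 → ℝ),
      (sys.C *ᵥ x + sys.D *ᵥ u) ⬝ᵥ (M *ᵥ (sys.C *ᵥ x' + sys.D *ᵥ u')) =
        (sys.A *ᵥ x + sys.B *ᵥ u) ⬝ᵥ (K *ᵥ x') + x ⬝ᵥ (K *ᵥ (sys.A *ᵥ x' + sys.B *ᵥ u')) +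
          ∑ k, (c k ⬝ᵥ x + e k * u 0) * (c k ⬝ᵥ x' + e k * u' 0) := by
  obtain ⟨m, v, hv⟩ := Matrix.posSemidef_iff_eq_sum_vecMulVec.1 hK.2.posSemidef
  refine ⟨m, fun k i => v k (Sum.inl i), fun k => v k (Sum.inr 0), fun x x' u u' => ?_⟩
  have h := congrArg (fun Q => Sum.elim x u ⬝ᵥ (Q *ᵥ Sum.elim x' u')) hv
  simp only [sub_mulVec, dotProduct_sub, sum_mulVec, dotProduct_sum] at h
  have h1 : Sum.elim x u ⬝ᵥ (((fromCols sys.C sys.D)ᵀ * M * fromCols sys.C sys.D) *ᵥ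
      Sum.elim x' u') =
      (sys.C *ᵥ x + sys.D *ᵥ u) ⬝ᵥ (M *ᵥ (sys.C *ᵥ x' + sys.D *ᵥ u')) := by
    rw [← mulVec_mulVec, ← mulVec_mulVec, dotProduct_mulVec, vecMul_transpose,
      fromCols_mulVec_sumElim, fromCols_mulVec_sumElim]
  have h2 : Sum.elim x u ⬝ᵥ (((fromBlocks sys.A sys.B (1 : Matrix ν ν ℝ) 0)ᵀ *
      fromBlocks 0 K K 0 * fromBlocks sys.A sys.B (1 : Matrix ν ν ℝ) 0) *ᵥ Sum.elim x' u') =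
      (sys.A *ᵥ x + sys.B *ᵥ u) ⬝ᵥ (K *ᵥ x') +
        x ⬝ᵥ (K *ᵥ (sys.A *ᵥ x' + sys.B *ᵥ u')) := by
    rw [← mulVec_mulVec, ← mulVec_mulVec, dotProduct_mulVec, vecMul_transpose]
    simp only [fromBlocks_mulVec, Sum.elim_comp_inl, Sum.elim_comp_inr, one_mulVec, zero_mulVec,
      add_zero, zero_add, sumElim_dotProduct_sumElim]
  have h3 (k : Fin m) : Sum.elim x u ⬝ᵥ (vecMulVec (v k) (star (v k)) *ᵥ Sum.elim x' u') =
      ((fun i => v k (Sum.inl i)) ⬝ᵥ x + v k (Sum.inr 0) * u 0) *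
        ((fun i => v k (Sum.inl i)) ⬝ᵥ x' + v k (Sum.inr 0) * u' 0) := by
    have hd (y : ν → ℝ) (a : Fin 1 → ℝ) : v k ⬝ᵥ Sum.elim y a =
        (fun i => v k (Sum.inl i)) ⬝ᵥ y + v k (Sum.inr 0) * a 0 := by
      simp [dotProduct, Fintype.sum_sum_type]
    rw [vecMulVec_mulVec, star_trivial, hd, dotProduct_smul, dotProduct_comm (Sum.elim x u), hd]
    rfl
  rw [h1, h2] at h
  simp only [h3] at h
  linarith

theorem HasDerivWithinAt.matrix_dotProduct {ν : Type*} [Fintype ν] {u v : ℝ → ν → ℝ}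
    {u' v' : ν → ℝ} {s : Set ℝ} {t : ℝ} (hu : HasDerivWithinAt u u' s t)
    (hv : HasDerivWithinAt v v' s t) :
    HasDerivWithinAt (fun t => u t ⬝ᵥ v t) (u' ⬝ᵥ v t + u t ⬝ᵥ v') s t := by
  rw [hasDerivWithinAt_pi] at hu hv
  simp only [dotProduct, ← Finset.sum_add_distrib]
  exact HasDerivWithinAt.fun_sum fun i _ => (hu i).mul (hv i)

theorem ContinuousOn.matrix_dotProduct {ν : Type*} [Fintype ν] {u v : ℝ → ν → ℝ} {s : Set ℝ}
    (hu : ContinuousOn u s) (hv : ContinuousOn v s) : ContinuousOn (fun t => u t ⬝ᵥ v t) s := by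
  rw [continuousOn_pi] at hu hv
  simp only [dotProduct]
  exact continuousOn_finsetSum _ fun i _ => (hu i).mul (hv i)

theorem mulVec_fin_one {ν : Type*} (B : Matrix ν (Fin 1) ℝ) (u : Fin 1 → ℝ) :
    B *ᵥ u = u 0 • fun j => B j 0 := by
  ext j; simp [mulVec, dotProduct, mul_comm]

/-- The scalar form of the frequency domain inequality for `[1; δ]`. -/
theorem StrictFDI.scalar_nonneg {P₀ : Matrix (Fin 2) (Fin 2) ℝ} (hP₀ : P₀.IsSymm)
    {δ : RatFunc ℝ} (h : StrictFDI !![1; δ] P₀) (ω : ℝ) :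
    0 ≤ P₀ 0 0 + 2 * P₀ 0 1 * (Polynomial.aeval (Complex.I * ω) δ.num /
        Polynomial.aeval (Complex.I * ω) δ.denom).re +
      P₀ 1 1 * Complex.normSq (Polynomial.aeval (Complex.I * ω) δ.num /
        Polynomial.aeval (Complex.I * ω) δ.denom) := by
  have h1 := (h.1 ω).diag_pos (i := 0)
  have hδ : RatFunc.eval (algebraMap ℝ ℂ) (Complex.I * ω) δ =
      Polynomial.aeval (Complex.I * ω) δ.num / Polynomial.aeval (Complex.I * ω) δ.denom := rfl
  simp only [Matrix.mul_apply, Fin.sum_univ_two, conjTranspose_apply, Matrix.map_apply] at h1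
  simp only [of_apply, cons_val', cons_val_zero, cons_val_one, cons_val_fin_one,
    RatFunc.eval_one, hδ] at h1
  set d := Polynomial.aeval (Complex.I * (ω : ℂ)) δ.num /
    Polynomial.aeval (Complex.I * (ω : ℂ)) δ.denom
  have h2 := (Complex.lt_def.1 h1).1.le
  refine h2.trans_eq ?_
  have h10 : P₀ 1 0 = P₀ 0 1 := hP₀.apply 0 1
  simp [Complex.normSq_apply, h10]
  ring

/-- Outputs of a filter driven by a signal are integrable and bounded on bounded intervals. -/
theorem IsSignal.filter_integrableOn_bound {ν : Type*} [Fintype ν] {u : ℝ → Fin 1 → ℝ}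
    (hu : IsSignal u) {ξ : ℝ → ν → ℝ} (hξ : ContinuousOn ξ (Ici 0)) (c : ν → ℝ) (e T : ℝ) :
    IntegrableOn (fun t => c ⬝ᵥ ξ t + e * u t 0) (Ioc 0 T) ∧
      ∃ C, ∀ t ∈ Ioc 0 T, ‖c ⬝ᵥ ξ t + e * u t 0‖ ≤ C := by
  have hc : ContinuousOn (fun t => c ⬝ᵥ ξ t) (Icc 0 T) :=
    (continuousOn_const.matrix_dotProduct hξ).mono Icc_subset_Ici_self
  obtain ⟨C, hC⟩ := isCompact_Icc.exists_bound_of_continuousOn hc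
  obtain ⟨C', hC'⟩ := hu.exists_bound T 0
  refine ⟨(hc.integrableOn_Icc.mono_set Ioc_subset_Icc_self).add
    ((hu.integrableOn T 0).const_mul e), C + ‖e‖ * C', fun t ht => ?_⟩
  refine (norm_add_le _ _).trans (add_le_add (hC t (Ioc_subset_Icc_self ht)) ?_)
  rw [norm_mul]
  exact mul_le_mul_of_nonneg_left (hC' t ht) (norm_nonneg e)

/-- The storage function `ξᵀ Z ξ` is recovered from its right derivative, which
need not be continuous. -/
theorem integral_storage_derivative {ν μ : Type*} [Fintype ν] [Fintype μ] (A Z : Matrix ν ν ℝ)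
    (B : Matrix ν μ ℝ) (ξ : ℝ → ν → ℝ) (u : ℝ → μ → ℝ) (h0 : ξ 0 = 0)
    (hξ : ContinuousOn ξ (Ici 0))
    (hξ' : ∀ t, 0 ≤ t → HasDerivWithinAt ξ (A *ᵥ ξ t + B *ᵥ u t) (Ici t) t) {T : ℝ} (hT : 0 ≤ T)
    (hu : ∀ i, IntegrableOn (fun t => u t i) (Ioc 0 T)) :
    IntervalIntegrable (fun t => (A *ᵥ ξ t + B *ᵥ u t) ⬝ᵥ (Z *ᵥ ξ t) +
        ξ t ⬝ᵥ (Z *ᵥ (A *ᵥ ξ t + B *ᵥ u t))) volume 0 T ∧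
      ∫ t in (0 : ℝ)..T, ((A *ᵥ ξ t + B *ᵥ u t) ⬝ᵥ (Z *ᵥ ξ t) +
        ξ t ⬝ᵥ (Z *ᵥ (A *ᵥ ξ t + B *ᵥ u t))) = ξ T ⬝ᵥ (Z *ᵥ ξ T) := by
  have hξT : ContinuousOn ξ (Icc 0 T) := hξ.mono Icc_subset_Ici_self
  have mul_int {a b : ℝ → ℝ} (ha : ContinuousOn a (Icc 0 T)) (hb : IntegrableOn b (Ioc 0 T)) :
      IntegrableOn (fun t => a t * b t) (Ioc 0 T) := by
    have hb' : IntegrableOn b (Icc 0 T) := by rwa [integrableOn_Icc_iff_integrableOn_Ioc]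
    exact (hb'.continuousOn_mul ha isCompact_Icc).mono_set Ioc_subset_Icc_self
  have hξi (i : ν) : IntegrableOn (fun t => ξ t i) (Ioc 0 T) :=
    ((continuousOn_pi.1 hξT) i).integrableOn_Icc.mono_set Ioc_subset_Icc_self
  have hd (i : ν) : IntegrableOn (fun t => (A *ᵥ ξ t + B *ᵥ u t) i) (Ioc 0 T) :=
    (integrableOn_mulVec_apply A hξi i).add (integrableOn_mulVec_apply B hu i)
  have hint : IntervalIntegrable (fun t => (A *ᵥ ξ t + B *ᵥ u t) ⬝ᵥ (Z *ᵥ ξ t) +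
      ξ t ⬝ᵥ (Z *ᵥ (A *ᵥ ξ t + B *ᵥ u t))) volume 0 T := by
    rw [intervalIntegrable_iff_integrableOn_Ioc_of_le hT]
    refine Integrable.add ?_ ?_
    · simp_rw [dotProduct_comm _ (Z *ᵥ ξ _)]
      exact integrable_finsetSum _ fun i _ =>
        mul_int ((continuousOn_pi.1 (hξT.matrix_mulVec_const Z)) i) (hd i)
    · exact integrable_finsetSum _ fun i _ =>
        mul_int ((continuousOn_pi.1 hξT) i) (integrableOn_mulVec_apply Z hd i)
  refine ⟨hint, ?_⟩
  rw [intervalIntegral.integral_eq_sub_of_hasDeriv_right_of_le hT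
    (f := fun t => ξ t ⬝ᵥ (Z *ᵥ ξ t)) (hξT.matrix_dotProduct (hξT.matrix_mulVec_const Z))
    (fun t ht => ((hξ' t ht.1.le).matrix_dotProduct
      ((hξ' t ht.1.le).matrix_mulVec Z)).mono Ioi_subset_Ici_self) hint]
  simp [h0]

theorem mainTheorem1
    (P₀ : Matrix (Fin 2) (Fin 2) ℝ) (hP₀ : P₀.IsSymm) (hr : P₀ 1 1 ≤ 0)
    (l n : ℕ) (ψ : Matrix (Fin l) (Fin 1) (RatFunc ℝ))
    (hψ : ∀ i, IsStableTransferFunction (ψ i 0))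
    (sysψ : StateSpace (Fin n) (Fin 1) (Fin l)) (hsysψ : sysψ.transferMatrix = ψ)
    (M : Matrix (Fin l) (Fin l) ℝ) (hM : M.IsSymm)
    (K : Matrix (Fin n) (Fin n) ℝ) (hK : sysψ.IsCertificate M K) :
    SatisfiesIQC (dynamicUncertainty P₀) (Matrix.fromBlocks ψ 0 0 ψ) (sysψ.diag sysψ)
      (kroneckerTwo P₀ M) (kroneckerTwo P₀ K) := by
  refine ⟨by rw [StateSpace.transferMatrix_diag, hsysψ], kroneckerTwo_isSymm hP₀ hM,
    kroneckerTwo_isSymm hP₀ hK.1, ?_⟩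
  rintro z w hz hw ⟨-, δ, hδ, hFDI, N, sysδ, x, hmin, htf, hx0, hx, hx', hxw⟩ ξ v
    ⟨hξ0, hξ, hξ', hv⟩ T hT
  obtain ⟨m, c, e, hsos⟩ := hK.exists_sum_of_squares
  have h10 : P₀ 1 0 = P₀ 0 1 := hP₀.apply 0 1
  -- the two halves of the filter state
  set ξ₁ : ℝ → Fin n → ℝ := fun t i => ξ t (Sum.inl i) with hξ₁
  set ξ₂ : ℝ → Fin n → ℝ := fun t i => ξ t (Sum.inr i) with hξ₂
  have hξe (t : ℝ) : ξ t = Sum.elim (ξ₁ t) (ξ₂ t) := by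
    ext (i | i) <;> rfl
  have hde (t : ℝ) : (sysψ.diag sysψ).A *ᵥ ξ t + (sysψ.diag sysψ).B *ᵥ Sum.elim (z t) (w t) =
      Sum.elim (sysψ.A *ᵥ ξ₁ t + sysψ.B *ᵥ z t) (sysψ.A *ᵥ ξ₂ t + sysψ.B *ᵥ w t) := by
    rw [hξe]
    ext (i | i) <;> simp [StateSpace.diag, fromBlocks_mulVec]
  have hve (t : ℝ) (ht : 0 ≤ t) :
      v t = Sum.elim (sysψ.C *ᵥ ξ₁ t + sysψ.D *ᵥ z t) (sysψ.C *ᵥ ξ₂ t + sysψ.D *ᵥ w t) := by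
    rw [hv t ht, hξe]
    ext (i | i) <;> simp [StateSpace.diag, fromBlocks_mulVec]
  have hξ₁c : ContinuousOn ξ₁ (Ici 0) :=
    continuousOn_pi.2 fun i => (continuousOn_pi.1 hξ) (Sum.inl i)
  have hξ₂c : ContinuousOn ξ₂ (Ici 0) :=
    continuousOn_pi.2 fun i => (continuousOn_pi.1 hξ) (Sum.inr i)
  have hξ₁' (t : ℝ) (ht : 0 ≤ t) :
      HasDerivWithinAt ξ₁ (sysψ.A *ᵥ ξ₁ t + z t 0 • fun j => sysψ.B j 0) (Ici t) t := by
    have h := hξ' t ht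
    rw [hde] at h
    rw [← mulVec_fin_one]
    exact hasDerivWithinAt_pi.2 fun i => (hasDerivWithinAt_pi.1 h) (Sum.inl i)
  have hξ₂' (t : ℝ) (ht : 0 ≤ t) :
      HasDerivWithinAt ξ₂ (sysψ.A *ᵥ ξ₂ t + w t 0 • fun j => sysψ.B j 0) (Ici t) t := by
    have h := hξ' t ht
    rw [hde] at h
    rw [← mulVec_fin_one]
    exact hasDerivWithinAt_pi.2 fun i => (hasDerivWithinAt_pi.1 h) (Sum.inr i)
  have hξ₁0 : ξ₁ 0 = 0 := by ext i; simp [hξ₁, hξ0]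
  have hξ₂0 : ξ₂ 0 = 0 := by ext i; simp [hξ₂, hξ0]
  have hw0 (t : ℝ) (ht : 0 ≤ t) : w t 0 = sysδ.C 0 ⬝ᵥ x t + sysδ.D 0 0 * z t 0 := by
    rw [hxw t ht, mulVec_fin_one sysδ.D]
    simp [mulVec, mul_comm]
  -- the linear forms of the sum of squares, evaluated along the two filter trajectories
  set y₁ : Fin m → ℝ → ℝ := fun k t => c k ⬝ᵥ ξ₁ t + e k * z t 0 with hy₁
  set y₂ : Fin m → ℝ → ℝ := fun k t => c k ⬝ᵥ ξ₂ t + e k * w t 0 with hy₂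
  set F : Fin m → ℝ → ℝ := fun k t =>
    P₀ 0 0 * y₁ k t ^ 2 + 2 * P₀ 0 1 * (y₁ k t * y₂ k t) + P₀ 1 1 * y₂ k t ^ 2 with hF
  have hFi (k : Fin m) : IntervalIntegrable (F k) volume 0 T := by
    obtain ⟨i1, C1, b1⟩ := hz.filter_integrableOn_bound hξ₁c (c k) (e k) T
    obtain ⟨i2, C2, b2⟩ := hw.filter_integrableOn_bound hξ₂c (c k) (e k) T
    have hmul {f g : ℝ → ℝ} {C : ℝ} (hf : IntegrableOn f (Ioc 0 T) volume)
        (hg : IntegrableOn g (Ioc 0 T) volume) (hC : ∀ t ∈ Ioc 0 T, ‖f t‖ ≤ C) :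
        IntegrableOn (fun t => f t * g t) (Ioc 0 T) volume :=
      Integrable.bdd_mul hg hf.aestronglyMeasurable
        ((ae_restrict_mem measurableSet_Ioc).mono hC)
    rw [intervalIntegrable_iff_integrableOn_Ioc_of_le hT]
    simp only [hF, sq]
    exact (((hmul i1 i1 b1).const_mul _).add ((hmul i1 i2 b1).const_mul _)).add
      ((hmul i2 i2 b2).const_mul _)
  have hFnn (k : Fin m) : 0 ≤ ∫ t in (0 : ℝ)..T, F k t := by
    obtain ⟨X, hX0, hX, hX', hXy⟩ := exists_response_of_filtered sysδ sysψ.A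
      (fun j => sysψ.B j 0) (c k) (e k) (fun t => z t 0) (fun t => w t 0) x ξ₁ ξ₂ hx0 hx
      (fun t ht => by rw [← mulVec_fin_one]; exact hx' t ht) hw0 hξ₁0 hξ₁c hξ₁' hξ₂0 hξ₂c hξ₂'
    obtain ⟨i1, C1, b1⟩ := hz.filter_integrableOn_bound hξ₁c (c k) (e k) T
    have h := integral_quadratic_filtered_nonneg (P₀ 0 0) (P₀ 0 1) (P₀ 1 1) hr δ hδ sysδ hmin htf
      (hFDI.scalar_nonneg hP₀) X (y₁ k) hX0 hX hX' hT i1 b1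
    refine h.trans_eq (intervalIntegral.integral_congr fun t ht => ?_)
    rw [uIcc_of_le hT] at ht
    simp only [hF]
    rw [show y₂ k t = _ from hXy t ht.1]
  obtain ⟨hVi, hV⟩ := integral_storage_derivative (sysψ.diag sysψ).A (kroneckerTwo P₀ K)
    (sysψ.diag sysψ).B ξ (fun t => Sum.elim (z t) (w t)) hξ0 hξ hξ' hT (by
      rintro (i | i)
      · exact hz.integrableOn T i
      · exact hw.integrableOn T i)
  have hpt : ∀ t ∈ uIcc 0 T, v t ⬝ᵥ (kroneckerTwo P₀ M *ᵥ v t) =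
      (((sysψ.diag sysψ).A *ᵥ ξ t + (sysψ.diag sysψ).B *ᵥ Sum.elim (z t) (w t)) ⬝ᵥ
          (kroneckerTwo P₀ K *ᵥ ξ t) +
        ξ t ⬝ᵥ (kroneckerTwo P₀ K *ᵥ
          ((sysψ.diag sysψ).A *ᵥ ξ t + (sysψ.diag sysψ).B *ᵥ Sum.elim (z t) (w t)))) +
        ∑ k, F k t := by
    intro t ht
    rw [uIcc_of_le hT] at ht
    have hsum : ∑ k, F k t = P₀ 0 0 * ∑ k, y₁ k t * y₁ k t + P₀ 0 1 * ∑ k, y₁ k t * y₂ k t +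
        P₀ 0 1 * ∑ k, y₂ k t * y₁ k t + P₀ 1 1 * ∑ k, y₂ k t * y₂ k t := by
      simp only [Finset.mul_sum, ← Finset.sum_add_distrib, hF]
      exact Finset.sum_congr rfl fun k _ => by ring
    rw [hde, hve t ht.1, hξe, sumElim_dotProduct_kroneckerTwo, sumElim_dotProduct_kroneckerTwo,
      sumElim_dotProduct_kroneckerTwo, hsum, hsos, hsos, hsos, hsos, h10]
    ring
  have hsum : ∫ t in (0 : ℝ)..T, v t ⬝ᵥ (kroneckerTwo P₀ M *ᵥ v t) =
      ξ T ⬝ᵥ (kroneckerTwo P₀ K *ᵥ ξ T) + ∑ k, ∫ t in (0 : ℝ)..T, F k t := by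
    have hFs : IntervalIntegrable (fun t => ∑ k, F k t) volume 0 T := by
      have h := IntervalIntegrable.sum Finset.univ fun k _ => hFi k
      rwa [show ∑ k, F k = fun t => ∑ k, F k t by ext; simp] at h
    rw [intervalIntegral.integral_congr hpt, intervalIntegral.integral_add hVi hFs, hV,
      intervalIntegral.integral_finsetSum fun k _ => hFi k]
  rw [hsum, add_sub_cancel_left]
  exact Finset.sum_nonneg fun k _ => hFnn k

end Certificate
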